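/- **Setting.** Let $(\Omega,\mathcal F,(\mathcal F_t)_{t\ge0},\mathbb P)$ be a filtered probability space, $\Delta_n=1/n$, and let prices be observed at the times $i\Delta_n$ up to a fixed horizon $T>0$, with $\Delta_i^nY=Y_{i\Delta_n}-Y_{(i-1)\Delta_n}$. The observed log-price is $Y=X+H$. The efficient log-price is an Itô semimartingale $$X_t=X_0+\int_0^t b_s\,ds+\int_0^t\sigma_s\,dW_s+\int_0^t\!\!\int_{\mathbb R}\delta(s,x)\,\mu(ds,dx),$$ with $W$ a Wiener process, $\mu$ a Poisson random measure with compensator $dt\otimes\nu(dx)$, $\delta$ predictable and jumps of finite variation. The noise is the drift burst $$H_t=\int_0^t c\,(s-\tau_n)^{-\vartheta}\mathbf 1_{\{s\in[\tau_n,\overline\tau]\}}\,ds,\qquad c\neq0,\ \vartheta\in(1/2,1),$$ where $c$ is a constant, $\tau_n\ge0$ is deterministic (or, more generally, $\mathcal F_0$-measurable) with $\tau_n\to0$ a.s., and $\overline\tau>0$ is a random variable, not depending on $n$, with $\overline\tau\ge\tau_n$ for all $n$. Let $\hat\sigma_t$ (depending on $n$) be spot volatility estimators. Let $\zeta>0$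 and $\varpi\in(0,1/2)$ be constants, $\xi=\xi_n>0$ a deterministic threshold and $w_n\in\mathbb N$ a window length. Put, for $k<l$, $$\widehat W_{k,l}=\sum_{i=k+1}^{l}\frac{\Delta_i^nY}{\hat\sigma_{(i-1)\Delta_n}}\mathbf 1_{\{|\Delta_i^nY|<\zeta\Delta_n^{\varpi}\}},\qquad \mathbf N^{\rm w}(\xi)=\inf\Big\{l>0:\ \max_{l-w_n\le k<l}\frac{|\widehat W_{k,l}|}{\sqrt{(l-k)\Delta_n}}>\xi\Big\},$$ where $0\le k<l\le nT$ and $\inf\emptyset=\infty$. **Theorem 2.** Suppose that, almost surely, $b_s=b_0$, $\sigma_s=\sigma_0$ and $\Delta X_s=0$ for all $s$ in a (possibly random) neighbourhood of $0$. Suppose that there are a deterministic sequence $\delta_n>0$ with $\delta_n\to0$, a number $\mathbb T>0$ and positive finite $\mathcal F_0$-measurable random variables $C_0,C_0'$ such that, with $l_n=\log(1/\delta_n)$, $\inf_{t\in[0,\mathbb T]}\sigma_t>0$ a.s. and, for all sufficiently large $n$ and all $t\in[0,\mathbb T]$, a.s. $$\mathbb E\big[|\hat\sigma_t-\sigma_t|^2\,\big|\,\mathcal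 F_0\big]\le C_0\,\delta_n^2,\qquad \hat\sigma_t>C_0'/l_n .$$ Let $\xi\Delta_n^{\iota}\to0$ for every $\iota>0$, and let $w_n\sim a_n\xi^2$ (that is, $w_n/(a_n\xi^2)\to1$) for a deterministic sequence $a_n$ converging to some $a\in(2/c^2,\infty]$. Then $$\mathbb P\big(\mathbf N^{\rm w}(\xi)>\tau_n/\Delta_n+T_n\big)\to0$$ for every deterministic sequence $T_n\to\infty$ such that $$T_n\Delta_n\to0,\qquad \frac{w_n}{T_n}\to0,\qquad \frac{T_n}{\Delta_n^{(1/2-\vartheta)/\vartheta}}\to\infty,\qquad \frac{\sqrt{w_n}\;l_n\,\delta_n\,\Delta_n^{\varpi-1/2}}{\xi\,T_n}\to0 .$$ -/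

import Mathlib

open MeasureTheory ProbabilityTheory Filter Topology Set
open scoped NNReal ENNReal

namespace RealTimeDetection

noncomputable section

/-! ### The efficient price: Itô semimartingales -/

/-- Lebesgue measure `dt` on the time axis `ℝ₊ = [0, ∞)`. -/
def timeVolume : Measure ℝ≥0 := (volume : Measure ℝ).comap (fun t : ℝ≥0 => (t : ℝ))

/-- `W` is a standard one-dimensional Wiener process relative to the filtration `F`. -/
structure IsWienerProcess {Ω : Type*} {mΩ : MeasurableSpace Ω} (F : Filtration ℝ≥0 mΩ)
    (P : Measure Ω) (W : ℝ≥0 → Ω → ℝ) : Prop where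
  isBrownian : IsBrownianReal W P
  adapted : ∀ t, Measurable[F t] (W t)
  indep : ∀ s t, s ≤ t →
    Indep (F s) (MeasurableSpace.comap (fun ω => W t ω - W s ω) inferInstance) P

/-- A bounded simple predictable process `∑ᵢ coef i · 𝟙_(time i, time (i+1)]`, `i < m`. -/
structure SimpleIntegrand {Ω : Type*} {mΩ : MeasurableSpace Ω} (F : Filtration ℝ≥0 mΩ) where
  m : ℕ
  time : ℕ → ℝ≥0
  time_mono : Monotone time
  coef : ℕ → Ω → ℝ
  coef_meas : ∀ i, Measurable[F (time i)] (coef i)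
  coef_bdd : ∃ C : ℝ, ∀ i ω, |coef i ω| ≤ C

/-- The value of a simple integrand at time `s`. -/
def SimpleIntegrand.val {Ω : Type*} {mΩ : MeasurableSpace Ω} {F : Filtration ℝ≥0 mΩ}
    (φ : SimpleIntegrand F) (s : ℝ≥0) (ω : Ω) : ℝ :=
  ∑ i ∈ Finset.range φ.m,
    (Set.Ioc (φ.time i) (φ.time (i + 1))).indicator (fun _ => φ.coef i ω) s

/-- The elementary stochastic integral `∫₀ᵗ φ dW` of a simple integrand. -/
def SimpleIntegrand.integral {Ω : Type*} {mΩ : MeasurableSpace Ω} {F : Filtration ℝ≥0 mΩ}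
    (φ : SimpleIntegrand F) (W : ℝ≥0 → Ω → ℝ) (t : ℝ≥0) (ω : Ω) : ℝ :=
  ∑ i ∈ Finset.range φ.m,
    φ.coef i ω * (W (min (φ.time (i + 1)) t) ω - W (min (φ.time i) t) ω)

/-- `I` is (a version of) the Itô integral process `∫₀ᵗ σ_s dW_s`: it has continuous paths and,
for simple integrands `φ k` with `∫₀ᵗ |φ k - σ|² ds → 0` in probability for all `t`, it is the
limit in probability of `∫₀ᵗ φ k dW`. -/
structure IsItoIntegral {Ω : Type*} {mΩ : MeasurableSpace Ω} (F : Filtration ℝ≥0 mΩ)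
    (P : Measure Ω) (W σ I : ℝ≥0 → Ω → ℝ) : Prop where
  continuous : ∀ᵐ ω ∂P, Continuous (fun t => I t ω)
  limit : ∃ φ : ℕ → SimpleIntegrand F, ∀ t : ℝ≥0,
    (∀ η : ℝ≥0∞, 0 < η → Tendsto
      (fun k => P {ω | η ≤ ∫⁻ s in Set.Iic t, ‖(φ k).val s ω - σ s ω‖ₑ ^ 2 ∂timeVolume}) atTop (𝓝 0)) ∧
    TendstoInMeasure P (fun k => (φ k).integral W t) atTop (I t)

/-- `N` is a Poisson random measure on `ℝ₊ × ℝ` relative to the filtration `F`, with compensator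
`dt ⊗ ν(dx)`. It is an integer-valued random measure: a sum of unit masses, at most one of them
at each time. -/
structure IsPoissonRandomMeasure {Ω : Type*} {mΩ : MeasurableSpace Ω} (F : Filtration ℝ≥0 mΩ)
    (P : Measure Ω) (ν : Measure ℝ) (N : Ω → Measure (ℝ≥0 × ℝ)) : Prop where
  measurable : Measurable N
  adapted : ∀ t : ℝ≥0, Measurable[F t] (fun ω => (N ω).restrict (Set.Iic t ×ˢ Set.univ))
  integer_valued : ∀ᵐ ω ∂P, ∃ D : Set (ℝ≥0 × ℝ), D.Countable ∧ Set.InjOn Prod.fst D ∧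
    N ω = Measure.sum (fun z : D => Measure.dirac (z : ℝ≥0 × ℝ))
  law : ∀ A : Set (ℝ≥0 × ℝ), MeasurableSet A → (timeVolume.prod ν) A ≠ ∞ →
    P.map (fun ω => N ω A) =
      (poissonMeasure ((timeVolume.prod ν) A).toNNReal).map (fun j : ℕ => (j : ℝ≥0∞))
  indep_disjoint : ∀ (m : ℕ) (A : Fin m → Set (ℝ≥0 × ℝ)), (∀ i, MeasurableSet (A i)) →
    Pairwise (fun i j => Disjoint (A i) (A j)) → iIndepFun (fun i ω => N ω (A i)) P
  indep_past : ∀ s : ℝ≥0, Indep (F s) (MeasurableSpace.comap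
    (fun ω => (N ω).restrict (Set.Ioi s ×ˢ Set.univ)) inferInstance) P

/-- `X` is an Itô semimartingale with finite variation jumps,
`X_t = X_0 + ∫₀ᵗ b_s ds + ∫₀ᵗ σ_s dW_s + ∫₀ᵗ∫_ℝ δ(s,x) N(ds,dx)`. -/
structure IsItoSemimartingale {Ω : Type*} {mΩ : MeasurableSpace Ω} (F : Filtration ℝ≥0 mΩ)
    (P : Measure Ω) (W : ℝ≥0 → Ω → ℝ) (ν : Measure ℝ) (N : Ω → Measure (ℝ≥0 × ℝ))
    (b σ : ℝ≥0 → Ω → ℝ) (jumpSize : Ω → ℝ≥0 → ℝ → ℝ) (X : ℝ≥0 → Ω → ℝ) : Prop where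
  wiener : IsWienerProcess F P W
  poisson : IsPoissonRandomMeasure F P ν N
  adapted : ∀ t, Measurable[F t] (X t)
  drift_prog : IsProgressive F b
  drift_int : ∀ᵐ ω ∂P, ∀ t : ℝ≥0, IntegrableOn (fun s => b s ω) (Set.Iic t) timeVolume
  vol_prog : IsProgressive F σ
  vol_int : ∀ᵐ ω ∂P, ∀ t : ℝ≥0, IntegrableOn (fun s => (σ s ω) ^ 2) (Set.Iic t) timeVolume
  jump_pred : Measurable[F.predictable.prod inferInstance]
    (fun z : (ℝ≥0 × Ω) × ℝ => jumpSize z.1.2 z.1.1 z.2)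
  jump_int : ∀ᵐ ω ∂P, ∀ t : ℝ≥0,
    IntegrableOn (fun z : ℝ≥0 × ℝ => jumpSize ω z.1 z.2) (Set.Ioc 0 t ×ˢ Set.univ) (N ω)
  decomposition : ∃ I : ℝ≥0 → Ω → ℝ, IsItoIntegral F P W σ I ∧
    ∀ᵐ ω ∂P, ∀ t : ℝ≥0, X t ω = X 0 ω + (∫ s in Set.Iic t, b s ω ∂timeVolume) + I t ω
      + ∫ z in Set.Ioc 0 t ×ˢ Set.univ, jumpSize ω z.1 z.2 ∂(N ω)

/-- The jump `ΔX_s = X_s - X_{s-}` of a path (with `X_{0-} = X_0`). -/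
def jump (x : ℝ≥0 → ℝ) (s : ℝ≥0) : ℝ := x s - Function.leftLim x s

/-! ### The drift burst -/

/-- The drift burst `H_t = ∫₀ᵗ c (s - τ)^(-ϑ) 𝟙{s ∈ [τ, τbar]} ds`. -/
def driftBurst (c ϑ τ τbar : ℝ) (t : ℝ≥0) : ℝ :=
  ∫ s in (0 : ℝ)..(t : ℝ), (Set.Icc τ τbar).indicator (fun s => c * (s - τ) ^ (-ϑ)) s

/-! ### Observations, the estimated Brownian increments and the detector -/

/-- The mesh `Δ_n = 1 / n`. -/
def mesh (n : ℕ) : ℝ := 1 / (n : ℝ)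

/-- The observation time `i Δ_n = i / n`. -/
def obsTime (n i : ℕ) : ℝ≥0 := (i : ℝ≥0) / (n : ℝ≥0)

/-- The increment `Δ_i^n y = y (i Δ_n) - y ((i - 1) Δ_n)`, for `i ≥ 1`. -/
def increment (n i : ℕ) (y : ℝ≥0 → ℝ) : ℝ := y (obsTime n i) - y (obsTime n (i - 1))

/-- The estimate of the Brownian increment over `(k, l]`, from the price path `y` and the path `s`
of the spot volatility estimator:
`∑_{i=k+1}^{l} (Δ_i^n y / s ((i - 1) Δ_n)) 𝟙{|Δ_i^n y| < ζ Δ_n^ϖ}`. -/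
def estBM (n : ℕ) (ζ ϖ : ℝ) (y s : ℝ≥0 → ℝ) (k l : ℕ) : ℝ :=
  ∑ i ∈ Finset.Ioc k l,
    if |increment n i y| < ζ * mesh n ^ ϖ then increment n i y / s (obsTime n (i - 1)) else 0

/-- The window-limited GLR-CUSUM stopping rule, with values in `ℕ ∪ {∞}`: the first `l > 0`, among
the observations `l ≤ n * horizon`, at which
`max_{l - w ≤ k < l} |estBM k l| / √((l - k) Δ_n) > ξ`. -/
def detector (n : ℕ) (horizon ζ ϖ : ℝ) (w : ℕ) (ξ : ℝ) (y s : ℝ≥0 → ℝ) : ℕ∞ :=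
  ⨅ l ∈ {l : ℕ | 0 < l ∧ (l : ℝ) ≤ (n : ℝ) * horizon ∧ ∃ k : ℕ, l ≤ k + w ∧ k < l ∧
      ξ < |estBM n ζ ϖ y s k l| / √(((l : ℝ) - (k : ℝ)) * mesh n)}, (l : ℕ∞)

/-! ### The assumption on the spot volatility estimator -/

/-- The sequence `l_n = log (1 / δ_n)`. -/
def logRate (δ : ℕ → ℝ) (n : ℕ) : ℝ := Real.log (1 / δ n)

/-- The accuracy of the spot volatility estimators `σhat n`, at rate `δ n`, near time zero. -/
def SpotVolAccuracy {Ω : Type*} {mΩ : MeasurableSpace Ω} (F : Filtration ℝ≥0 mΩ)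
    (P : Measure Ω) (σ : ℝ≥0 → Ω → ℝ) (σhat : ℕ → ℝ≥0 → Ω → ℝ) (δ : ℕ → ℝ) : Prop :=
  (∀ n, 0 < δ n) ∧ Tendsto δ atTop (𝓝 0) ∧
  ∃ t₀ : ℝ≥0, 0 < t₀ ∧
    (∀ᵐ ω ∂P, ∃ r : ℝ, 0 < r ∧ ∀ t ≤ t₀, r ≤ σ t ω) ∧
    (∃ C : Ω → ℝ, Measurable[F 0] C ∧ (∀ ω, 0 < C ω) ∧ ∀ᶠ n in atTop, ∀ t ≤ t₀,
      condLExp (F 0) P (fun ω => ENNReal.ofReal (|σhat n t ω - σ t ω| ^ 2))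
        ≤ᵐ[P] fun ω => ENNReal.ofReal (C ω * δ n ^ 2)) ∧
    (∃ C : Ω → ℝ, Measurable[F 0] C ∧ (∀ ω, 0 < C ω) ∧ ∀ᶠ n in atTop, ∀ t ≤ t₀,
      ∀ᵐ ω ∂P, C ω / logRate δ n < σhat n t ω)

end

end RealTimeDetection

/-!
The delay bound is generous. Since `T` is eventually larger than `mesh ^ ((1 / 2 - ϑ) / ϑ)`, there
is room to detect the burst well before `T` observations have passed, at a distance
`u = mesh ^ (β / ϑ)` from its start `τ`, where `1 / 2 < β < min ϑ (1 - ϖ)`. There the increments of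
the burst are of the order `mesh ^ (1 - β)`: they exceed the Brownian increments, of order
`√mesh`, by the diverging factor `M = mesh ^ (1 / 2 - β)`, and still lie below the truncation level
`ζ * mesh ^ ϖ` (`driftBurst_increment`, `IsBurstExponent.increment_lt_truncation`).

Take a window of `v = min w ⌈ξ ^ 2⌉` observations there. The assumption on `w` gives `ξ ^ 2 = O(v)`,
and `v` grows more slowly than any power of `1 / mesh`, so that the window spans a time of
length at most `u`. The sum of the
rescaled increments has a signal of order `v * √mesh * M`, and the threshold multiplied by the
normalization, `ξ * √(v * mesh)`, is only `O(v * √mesh)`. The drift, the sum of the Brownian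
increments and the error made by replacing `σ` by its estimate are of smaller order than the
signal too. As `M` diverges, crude second moment bounds suffice for this: by the Cauchy-Schwarz
inequality it is enough to control the sums of squares of the Brownian increments and of the
estimation errors over the window (`estimate_lower_bound`), and this is Markov's inequality, applied
conditionally on `F 0` because the position of the window depends on `τ`
(`measure_window_sum_gt_le`).

It remains to see that near time zero the efficient price is `X 0 + b 0 * t + σ 0 * W t`
(`IsItoSemimartingale.eq_near_zero`). The absence of jumps of `X` forces the jump integral to vanish
there (`setIntegral_eq_zero_of_jump_eq_zero`). The Itô integral, given as a limit in probability
of elementary integrals, is local: on the event that `σ` is constant up to time `t` it equals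
`σ 0 * W t` (`IsItoIntegral.eq_mul_of_const`), by a Lenglart inequality for elementary integrals
(`measure_wienerSum_ge_le`).
-/

namespace RealTimeDetection

noncomputable section

section

variable {Ω : Type*} {mΩ : MeasurableSpace Ω} {F : Filtration ℝ≥0 mΩ} {P : Measure Ω}

/-! ### The time axis -/

lemma timeVolume_apply (s : Set ℝ≥0) : timeVolume s = volume ((fun t : ℝ≥0 => (t : ℝ)) '' s) :=
  (MeasurableEmbedding.subtype_coe measurableSet_Ici).comap_apply _ _

lemma timeVolume_Ioc (a b : ℝ≥0) : timeVolume (Ioc a b) = ENNReal.ofReal ((b : ℝ) - a) := by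
  have h : (fun t : ℝ≥0 => (t : ℝ)) '' Ioc a b = Ioc (a : ℝ) b := by
    ext x
    constructor
    · rintro ⟨y, hy, rfl⟩
      exact ⟨by exact_mod_cast hy.1, by exact_mod_cast hy.2⟩
    · rintro ⟨h1, h2⟩
      exact ⟨⟨x, a.2.trans h1.le⟩, ⟨h1, h2⟩, rfl⟩
  rw [timeVolume_apply, h, Real.volume_Ioc]

lemma timeVolume_Iic (b : ℝ≥0) : timeVolume (Iic b) = ENNReal.ofReal b := by
  have h : (fun t : ℝ≥0 => (t : ℝ)) '' Iic b = Icc 0 (b : ℝ) := by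
    ext x
    constructor
    · rintro ⟨y, hy, rfl⟩
      exact ⟨y.2, by exact_mod_cast hy⟩
    · rintro ⟨h1, h2⟩
      exact ⟨⟨x, h1⟩, h2, rfl⟩
  rw [timeVolume_apply, h, Real.volume_Icc, sub_zero]

/-! ### Elementary stochastic integrals -/

lemma IsWienerProcess.memLp_increment {W : ℝ≥0 → Ω → ℝ} (hW : IsWienerProcess F P W)
    (s t : ℝ≥0) : MemLp (fun ω => W t ω - W s ω) 2 P :=
  (hW.isBrownian.hasLaw_sub t s).hasGaussianLaw.memLp_two

lemma IsWienerProcess.integral_increment {W : ℝ≥0 → Ω → ℝ} (hW : IsWienerProcess F P W)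
    (s t : ℝ≥0) : ∫ ω, (W t ω - W s ω) ∂P = 0 := by
  have := (hW.isBrownian.hasLaw_sub t s).integral_eq
  rwa [integral_id_gaussianReal] at this

lemma IsWienerProcess.integral_sq_increment {W : ℝ≥0 → Ω → ℝ} (hW : IsWienerProcess F P W)
    {s t : ℝ≥0} (hst : s ≤ t) : ∫ ω, (W t ω - W s ω) ^ 2 ∂P = (t : ℝ) - s := by
  have h1 := (hW.isBrownian.hasLaw_sub t s).variance_eq
  rw [variance_id_gaussianReal, variance_of_integral_eq_zero
    (hW.isBrownian.hasLaw_sub t s).aemeasurable (hW.integral_increment s t)] at h1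
  simp only [Pi.sub_apply] at h1
  rw [h1, coe_nndist, Real.dist_eq, abs_of_nonneg]
  · rfl
  · have : (s : ℝ) ≤ t := by exact_mod_cast hst
    exact sub_nonneg.2 this

lemma IsWienerProcess.lintegral_sq_increment {W : ℝ≥0 → Ω → ℝ} (hW : IsWienerProcess F P W)
    {s t : ℝ≥0} (hst : s ≤ t) :
    ∫⁻ ω, ENNReal.ofReal ((W t ω - W s ω) ^ 2) ∂P = ENNReal.ofReal ((t : ℝ) - s) := by
  rw [← hW.integral_sq_increment hst, ofReal_integral_eq_lintegral_ofReal
    (hW.memLp_increment s t).integrable_sq (ae_of_all _ fun ω => sq_nonneg _)]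

lemma IsWienerProcess.measurable {W : ℝ≥0 → Ω → ℝ} (hW : IsWienerProcess F P W) (t : ℝ≥0) :
    Measurable (W t) := (hW.adapted t).mono (F.le t) le_rfl

/-- A random variable known at time `s` is independent of the increments of `W` after `s`. -/
lemma IsWienerProcess.indepFun_increment {W : ℝ≥0 → Ω → ℝ} (hW : IsWienerProcess F P W)
    {s t : ℝ≥0} (hst : s ≤ t) {f : Ω → ℝ} (hf : Measurable[F s] f) :
    IndepFun f (fun ω => W t ω - W s ω) P :=
  indep_of_indep_of_le_left (hW.indep s t hst) hf.comap_le

/-- The elementary integral `∑_{i<m} c_i (W_{t_{i+1}} - W_{t_i})`. -/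
def wienerSum (W : ℝ≥0 → Ω → ℝ) (t : ℕ → ℝ≥0) (c : ℕ → Ω → ℝ) (m : ℕ) (ω : Ω) : ℝ :=
  ∑ i ∈ Finset.range m, c i ω * (W (t (i + 1)) ω - W (t i) ω)

lemma measurable_wienerSum {W : ℝ≥0 → Ω → ℝ} (hW : IsWienerProcess F P W) {t : ℕ → ℝ≥0}
    (ht : Monotone t) {c : ℕ → Ω → ℝ} (hc : ∀ i, Measurable[F (t i)] (c i)) (m : ℕ) :
    Measurable[F (t m)] (wienerSum W t c m) := by
  unfold wienerSum
  refine Finset.measurable_fun_sum _ fun i hi => ?_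
  have him : i < m := Finset.mem_range.1 hi
  exact ((hc i).mono (F.mono (ht him.le)) le_rfl).mul
    (((hW.adapted _).mono (F.mono (ht him)) le_rfl).sub
      ((hW.adapted _).mono (F.mono (ht him.le)) le_rfl))

/-- The Itô isometry for elementary integrals with bounded coefficients. -/
lemma wienerSum_isometry [IsProbabilityMeasure P] {W : ℝ≥0 → Ω → ℝ}
    (hW : IsWienerProcess F P W) {t : ℕ → ℝ≥0}
    (ht : Monotone t) {c : ℕ → Ω → ℝ} (hc : ∀ i, Measurable[F (t i)] (c i))
    {K : ℝ} (hK : ∀ i ω, c i ω ^ 2 * ((t (i + 1) : ℝ) - t i) ≤ K) (m : ℕ) :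
    MemLp (wienerSum W t c m) 2 P ∧ ∫ ω, wienerSum W t c m ω ^ 2 ∂P =
      ∑ i ∈ Finset.range m, ∫ ω, c i ω ^ 2 * ((t (i + 1) : ℝ) - t i) ∂P := by
  induction m with
  | zero =>
    have h0 : wienerSum W t c 0 = fun _ => 0 := by
      funext ω
      simp [wienerSum]
    simp [h0]
  | succ m ih =>
    have hsucc : wienerSum W t c (m + 1) =
        fun ω => wienerSum W t c m ω + c m ω * (W (t (m + 1)) ω - W (t m) ω) := by
      funext ω
      simp [wienerSum, Finset.sum_range_succ]
    rw [Finset.sum_range_succ, hsucc, ← ih.2]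
    rcases (ht m.le_succ).eq_or_lt with heq | hlt
    · simp only [Nat.succ_eq_add_one] at heq
      simp only [← heq, sub_self, mul_zero, add_zero, integral_zero]
      exact ⟨ih.1, trivial⟩
    simp only [Nat.succ_eq_add_one] at hlt
    have hd : (0 : ℝ) < (t (m + 1) : ℝ) - t m := sub_pos.2 (by exact_mod_cast hlt)
    have hcm : Measurable (c m) := (hc m).mono (F.le _) le_rfl
    have hbd : ∀ ω, ‖c m ω‖ ≤ √(K / ((t (m + 1) : ℝ) - t m)) := fun ω => by
      rw [Real.norm_eq_abs]
      exact Real.abs_le_sqrt ((le_div_iff₀ hd).2 (hK m ω))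
    have hY := hW.memLp_increment (t m) (t (m + 1))
    have hcY : MemLp (fun ω => c m ω * (W (t (m + 1)) ω - W (t m) ω)) 2 P :=
      MemLp.of_le_mul hY (hcm.aestronglyMeasurable.mul hY.1)
        (ae_of_all _ fun ω => by
          rw [norm_mul]; exact mul_le_mul_of_nonneg_right (hbd ω) (norm_nonneg _))
    refine ⟨ih.1.add hcY, ?_⟩
    have hM := measurable_wienerSum hW ht hc m
    have h0 : ∫ ω, wienerSum W t c m ω * (c m ω * (W (t (m + 1)) ω - W (t m) ω)) ∂P = 0 := by
      have h := (hW.indepFun_increment hlt.le (hM.mul (hc m))).integral_mul_eq_mul_integral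
        ((hM.mul (hc m)).mono (F.le _) le_rfl).aestronglyMeasurable hY.1
      rw [hW.integral_increment, mul_zero] at h
      rw [← h]
      congr 1
      funext ω
      simp only [Pi.mul_apply]
      ring
    have h1 : ∫ ω, (c m ω * (W (t (m + 1)) ω - W (t m) ω)) ^ 2 ∂P =
        ∫ ω, c m ω ^ 2 * ((t (m + 1) : ℝ) - t m) ∂P := by
      have hi : IndepFun (fun ω => c m ω ^ 2) (fun ω => (W (t (m + 1)) ω - W (t m) ω) ^ 2) P :=
        (hW.indepFun_increment hlt.le (hc m)).comp (φ := fun x => x ^ 2) (ψ := fun x => x ^ 2)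
          (by fun_prop) (by fun_prop)
      have h := hi.integral_mul_eq_mul_integral (hcm.pow_const 2).aestronglyMeasurable
        hY.integrable_sq.1
      rw [hW.integral_sq_increment hlt.le, ← integral_mul_const] at h
      rw [← h]
      congr 1
      funext ω
      simp only [Pi.mul_apply]
      ring
    have hexp : ∀ ω, (wienerSum W t c m ω + c m ω * (W (t (m + 1)) ω - W (t m) ω)) ^ 2 =
        wienerSum W t c m ω ^ 2
        + 2 * (wienerSum W t c m ω * (c m ω * (W (t (m + 1)) ω - W (t m) ω)))
        + (c m ω * (W (t (m + 1)) ω - W (t m) ω)) ^ 2 := fun ω => by ring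
    have hi2 : Integrable
        (fun ω => 2 * (wienerSum W t c m ω * (c m ω * (W (t (m + 1)) ω - W (t m) ω)))) P :=
      (ih.1.integrable_mul hcY).const_mul 2
    have hi12 : Integrable (fun ω => wienerSum W t c m ω ^ 2
        + 2 * (wienerSum W t c m ω * (c m ω * (W (t (m + 1)) ω - W (t m) ω)))) P :=
      ih.1.integrable_sq.add hi2
    simp_rw [hexp]
    rw [integral_add hi12 hcY.integrable_sq,
      integral_add ih.1.integrable_sq hi2, integral_const_mul, h0, h1]
    ring

/-- Lenglart's inequality for elementary integrals: an elementary integral can be large only where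
its quadratic variation is. The coefficients are stopped as soon as the quadratic variation is
about to exceed `η`, which keeps them adapted. -/
lemma measure_wienerSum_ge_le [IsProbabilityMeasure P] {W : ℝ≥0 → Ω → ℝ}
    (hW : IsWienerProcess F P W) {t : ℕ → ℝ≥0}
    (ht : Monotone t) {c : ℕ → Ω → ℝ} (hc : ∀ i, Measurable[F (t i)] (c i))
    {η ε : ℝ} (hη : 0 < η) (hε : 0 < ε) (m : ℕ) :
    P {ω | ∑ i ∈ Finset.range m, c i ω ^ 2 * ((t (i + 1) : ℝ) - t i) ≤ η ∧
      ε ≤ |wienerSum W t c m ω|} ≤ ENNReal.ofReal (η / ε ^ 2) := by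
  classical
  have hd : ∀ i, (0 : ℝ) ≤ (t (i + 1) : ℝ) - t i := fun i =>
    sub_nonneg.2 (by exact_mod_cast ht i.le_succ)
  set q : ℕ → Ω → ℝ := fun j ω => ∑ i ∈ Finset.range j, c i ω ^ 2 * ((t (i + 1) : ℝ) - t i) with hq
  have hqmono : ∀ ω, Monotone (fun j => q j ω) := fun ω => monotone_nat_of_le_succ fun j => by
    simp only [hq, Finset.sum_range_succ]
    exact le_add_of_nonneg_right (mul_nonneg (sq_nonneg _) (hd j))
  have hqmeas : ∀ j, Measurable[F (t j)] (q (j + 1)) := fun j =>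
    Finset.measurable_fun_sum _ fun i hi =>
      (((hc i).mono (F.mono (ht (Nat.lt_succ_iff.1 (Finset.mem_range.1 hi)))) le_rfl).pow_const
        2).mul_const _
  set c' : ℕ → Ω → ℝ := fun i ω => if q (i + 1) ω ≤ η then c i ω else 0 with hc'
  have hc'meas : ∀ i, Measurable[F (t i)] (c' i) := fun i =>
    Measurable.ite (measurableSet_le (hqmeas i) measurable_const) (hc i) measurable_const
  have hsum : ∀ ω j, ∑ i ∈ Finset.range j, c' i ω ^ 2 * ((t (i + 1) : ℝ) - t i) ≤ η := by
    intro ω j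
    induction j with
    | zero => simpa using hη.le
    | succ j ih =>
      rw [Finset.sum_range_succ]
      by_cases h : q (j + 1) ω ≤ η
      · refine le_trans ?_ h
        have hall : ∀ i ≤ j, c' i ω = c i ω := fun i hi =>
          if_pos (((hqmono ω) (Nat.succ_le_succ hi)).trans h)
        simp only [hq, Finset.sum_range_succ]
        rw [hall j le_rfl]
        refine add_le_add_left (Finset.sum_le_sum fun i hi => ?_) _
        rw [hall i (Finset.mem_range.1 hi).le]
      · have : c' j ω = 0 := if_neg h
        rw [this]
        simpa using ih
  have hK : ∀ i ω, c' i ω ^ 2 * ((t (i + 1) : ℝ) - t i) ≤ η := fun i ω =>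
    (Finset.single_le_sum (f := fun i => c' i ω ^ 2 * ((t (i + 1) : ℝ) - t i))
      (fun j _ => mul_nonneg (sq_nonneg _) (hd j)) (Finset.self_mem_range_succ i)).trans
        (hsum ω (i + 1))
  obtain ⟨hL2, hiso⟩ := wienerSum_isometry hW ht hc'meas hK m
  have hint : ∫ ω, wienerSum W t c' m ω ^ 2 ∂P ≤ η := by
    have hI : ∀ i, Integrable (fun ω => c' i ω ^ 2 * ((t (i + 1) : ℝ) - t i)) P := fun i =>
      Integrable.of_bound
        ((((hc'meas i).mono (F.le _) le_rfl).pow_const 2).mul_const _).aestronglyMeasurable η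
        (ae_of_all _ fun ω => by
          rw [Real.norm_eq_abs, abs_of_nonneg (mul_nonneg (sq_nonneg _) (hd i))]
          exact hK i ω)
    rw [hiso, ← integral_finsetSum _ fun i _ => hI i]
    calc _ ≤ ∫ _, η ∂P := integral_mono (integrable_finsetSum _ fun i _ => hI i)
          (integrable_const _) (fun ω => hsum ω m)
      _ = η := by simp
  have hsub : {ω | q m ω ≤ η ∧ ε ≤ |wienerSum W t c m ω|} ⊆
      {ω | ENNReal.ofReal (ε ^ 2) ≤ ENNReal.ofReal (wienerSum W t c' m ω ^ 2)} := by
    rintro ω ⟨h1, h2⟩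
    have : wienerSum W t c' m ω = wienerSum W t c m ω := by
      refine Finset.sum_congr rfl fun i hi => ?_
      have : c' i ω = c i ω := if_pos (((hqmono ω) (Finset.mem_range.1 hi)).trans h1)
      rw [this]
    simp only [mem_ofPred_eq]
    rw [this]
    refine ENNReal.ofReal_le_ofReal ?_
    rw [← sq_abs (wienerSum W t c m ω)]
    exact pow_le_pow_left₀ hε.le h2 2
  refine (measure_mono hsub).trans ?_
  have hmk := meas_ge_le_lintegral_div (μ := P)
    (f := fun ω => ENNReal.ofReal (wienerSum W t c' m ω ^ 2))
    (hL2.integrable_sq.1.aemeasurable.ennreal_ofReal) (ε := ENNReal.ofReal (ε ^ 2))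
    (by simp [hε.ne']) ENNReal.ofReal_ne_top
  refine hmk.trans ?_
  rw [← ofReal_integral_eq_lintegral_ofReal hL2.integrable_sq (ae_of_all _ fun ω => sq_nonneg _),
    ← ENNReal.ofReal_div_of_pos (by positivity)]
  exact ENNReal.ofReal_le_ofReal (by gcongr)

/-! ### Locality of the Itô integral -/

lemma SimpleIntegrand.val_of_mem (φ : SimpleIntegrand F) {j : ℕ} (hj : j < φ.m) {s : ℝ≥0}
    (hs : s ∈ Ioc (φ.time j) (φ.time (j + 1))) (ω : Ω) : φ.val s ω = φ.coef j ω := by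
  unfold SimpleIntegrand.val
  rw [Finset.sum_eq_single j, indicator_of_mem hs]
  · intro i _ hij
    refine indicator_of_notMem (fun hi => ?_) _
    rcases hij.lt_or_gt with h | h
    · exact absurd (hi.2.trans (φ.time_mono h)) (not_le.2 hs.1)
    · exact absurd (hs.2.trans (φ.time_mono h)) (not_le.2 hi.1)
  · intro h
    exact absurd (Finset.mem_range.2 hj) h

lemma SimpleIntegrand.val_of_le (φ : SimpleIntegrand F) {s : ℝ≥0} (hs : s ≤ φ.time 0) (ω : Ω) :
    φ.val s ω = 0 :=
  Finset.sum_eq_zero fun i _ => indicator_of_notMem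
    (fun hi => absurd (hs.trans (φ.time_mono i.zero_le)) (not_le.2 hi.1)) _

lemma SimpleIntegrand.val_of_gt (φ : SimpleIntegrand F) {s : ℝ≥0} (hs : φ.time φ.m < s) (ω : Ω) :
    φ.val s ω = 0 :=
  Finset.sum_eq_zero fun _ hi => indicator_of_notMem
    (fun h => absurd (h.2.trans (φ.time_mono (Finset.mem_range.1 hi))) (not_le.2 hs)) _

/-- The grid `0, time 0 ∧ t, …, time m ∧ t, t, t, …` of a simple integrand stopped at `t`, extended
so that it covers `[0, t]`. -/
def SimpleIntegrand.grid (φ : SimpleIntegrand F) (t : ℝ≥0) : ℕ → ℝ≥0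
  | 0 => 0
  | j + 1 => if j ≤ φ.m then min (φ.time j) t else t

/-- The coefficients of `φ - f` on `SimpleIntegrand.grid`, for a random variable `f` constant in
time. Where the grid interval is empty, the value `-f` is chosen because it is known at
time zero. -/
def SimpleIntegrand.gridCoef (φ : SimpleIntegrand F) (t : ℝ≥0) (f : Ω → ℝ) : ℕ → Ω → ℝ
  | 0 => fun ω => -f ω
  | j + 1 => fun ω => if j < φ.m ∧ φ.time j ≤ t then φ.coef j ω - f ω else -f ω

lemma SimpleIntegrand.grid_mono (φ : SimpleIntegrand F) (t : ℝ≥0) : Monotone (φ.grid t) := by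
  refine monotone_nat_of_le_succ fun i => ?_
  cases i with
  | zero => exact zero_le
  | succ j =>
    simp only [SimpleIntegrand.grid]
    split_ifs with h1 h2
    · exact min_le_min_right _ (φ.time_mono j.le_succ)
    · exact min_le_right _ _
    · omega
    · exact le_rfl

lemma SimpleIntegrand.grid_le (φ : SimpleIntegrand F) (t : ℝ≥0) (i : ℕ) : φ.grid t i ≤ t := by
  cases i with
  | zero => exact zero_le
  | succ j =>
    simp only [SimpleIntegrand.grid]
    split_ifs
    · exact min_le_right _ _
    · exact le_rfl

lemma SimpleIntegrand.measurable_gridCoef (φ : SimpleIntegrand F) (t : ℝ≥0) {f : Ω → ℝ}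
    (hf : Measurable[F 0] f) (i : ℕ) : Measurable[F (φ.grid t i)] (φ.gridCoef t f i) := by
  cases i with
  | zero => exact hf.neg
  | succ j =>
    have hf' : Measurable[F (φ.grid t (j + 1))] f := hf.mono (F.mono zero_le) le_rfl
    by_cases h : j < φ.m ∧ φ.time j ≤ t
    · have hg : φ.grid t (j + 1) = φ.time j := by
        simp [SimpleIntegrand.grid, h.1.le, h.2]
      have hc : φ.gridCoef t f (j + 1) = fun ω => φ.coef j ω - f ω := by
        funext ω
        simp [SimpleIntegrand.gridCoef, h]
      rw [hc]
      refine Measurable.sub ?_ hf'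
      rw [hg]
      exact φ.coef_meas j
    · have hc : φ.gridCoef t f (j + 1) = fun ω => -f ω := by
        funext ω
        simp only [SimpleIntegrand.gridCoef, if_neg h]
      rw [hc]
      exact hf'.neg

lemma SimpleIntegrand.wienerSum_grid (φ : SimpleIntegrand F) (W : ℝ≥0 → Ω → ℝ) (t : ℝ≥0)
    (f : Ω → ℝ) (ω : Ω) :
    wienerSum W (φ.grid t) (φ.gridCoef t f) (φ.m + 2) ω =
      φ.integral W t ω - f ω * (W t ω - W 0 ω) := by
  unfold wienerSum SimpleIntegrand.integral
  rw [Finset.sum_range_succ, Finset.sum_range_succ']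
  have h1 : ∀ j ∈ Finset.range φ.m, φ.gridCoef t f (j + 1) ω *
      (W (φ.grid t (j + 1 + 1)) ω - W (φ.grid t (j + 1)) ω) =
      φ.coef j ω * (W (min (φ.time (j + 1)) t) ω - W (min (φ.time j) t) ω)
      - f ω * (W (min (φ.time (j + 1)) t) ω - W (min (φ.time j) t) ω) := by
    intro j hj
    have hj : j < φ.m := Finset.mem_range.1 hj
    have hj' : j + 1 ≤ φ.m := hj
    simp only [SimpleIntegrand.grid, SimpleIntegrand.gridCoef, hj.le, hj', hj, if_true, true_and]
    by_cases h : φ.time j ≤ t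
    · rw [if_pos h]
      ring
    · have h' : t ≤ φ.time j := (not_le.1 h).le
      rw [min_eq_right h', min_eq_right (h'.trans (φ.time_mono j.le_succ))]
      ring
  rw [Finset.sum_congr rfl h1, Finset.sum_sub_distrib, ← Finset.mul_sum,
    Finset.sum_range_sub (fun j => W (min (φ.time j) t) ω)]
  simp [SimpleIntegrand.grid, SimpleIntegrand.gridCoef]
  ring

lemma SimpleIntegrand.val_sub_of_mem_grid (φ : SimpleIntegrand F) (t : ℝ≥0) (f : Ω → ℝ) (ω : Ω)
    {i : ℕ} (hi : i < φ.m + 2) {s : ℝ≥0} (hs : s ∈ Ioc (φ.grid t i) (φ.grid t (i + 1))) :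
    φ.val s ω - f ω = φ.gridCoef t f i ω := by
  cases i with
  | zero =>
    have hs2 := hs.2
    simp only [SimpleIntegrand.grid, Nat.zero_le, if_true] at hs2
    rw [φ.val_of_le (hs2.trans (min_le_left _ _))]
    simp [SimpleIntegrand.gridCoef]
  | succ j =>
    have hst : s ≤ t := hs.2.trans (φ.grid_le t _)
    obtain ⟨hs1, hs2⟩ := hs
    have hjm : j ≤ φ.m := by omega
    simp only [SimpleIntegrand.grid, hjm, if_true] at hs1
    have hlt : φ.time j < s := (min_lt_iff.1 hs1).resolve_right (not_lt.2 hst)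
    rcases hjm.lt_or_eq with h | h
    · have hj' : j + 1 ≤ φ.m := h
      simp only [SimpleIntegrand.grid, hj', if_true] at hs2
      rw [φ.val_of_mem h ⟨hlt, hs2.trans (min_le_left _ _)⟩]
      simp [SimpleIntegrand.gridCoef, h, hlt.le.trans hst]
    · rw [φ.val_of_gt (h ▸ hlt)]
      simp [SimpleIntegrand.gridCoef, h]

lemma SimpleIntegrand.quadraticVariation_le (φ : SimpleIntegrand F) (t : ℝ≥0) (f : Ω → ℝ)
    (ω : Ω) :
    ENNReal.ofReal (∑ i ∈ Finset.range (φ.m + 2),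
      φ.gridCoef t f i ω ^ 2 * ((φ.grid t (i + 1) : ℝ) - φ.grid t i)) ≤
      ∫⁻ s in Iic t, ‖φ.val s ω - f ω‖ₑ ^ 2 ∂timeVolume := by
  rw [ENNReal.ofReal_sum_of_nonneg fun i _ => mul_nonneg (sq_nonneg _)
    (sub_nonneg.2 (by exact_mod_cast φ.grid_mono t i.le_succ))]
  have h : ∀ i ∈ Finset.range (φ.m + 2),
      ENNReal.ofReal (φ.gridCoef t f i ω ^ 2 * ((φ.grid t (i + 1) : ℝ) - φ.grid t i)) =
      ∫⁻ s in Ioc (φ.grid t i) (φ.grid t (i + 1)), ‖φ.val s ω - f ω‖ₑ ^ 2 ∂timeVolume := by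
    intro i hi
    rw [setLIntegral_congr_fun (g := fun _ => ‖φ.gridCoef t f i ω‖ₑ ^ 2) measurableSet_Ioc
      (fun s hs => by simp only [φ.val_sub_of_mem_grid t f ω (Finset.mem_range.1 hi) hs]),
      setLIntegral_const, timeVolume_Ioc, ENNReal.ofReal_mul (sq_nonneg _),
      ← ofReal_norm, ← ENNReal.ofReal_pow (norm_nonneg _), Real.norm_eq_abs, sq_abs]
  have hdisj : Set.PairwiseDisjoint (↑(Finset.range (φ.m + 2)))
      (fun i => Ioc (φ.grid t i) (φ.grid t (i + 1))) :=
    fun i _ j _ hij => (φ.grid_mono t).pairwise_disjoint_on_Ioc_succ hij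
  rw [Finset.sum_congr rfl h, ← lintegral_biUnion_finset hdisj fun i _ => measurableSet_Ioc]
  exact lintegral_mono_set (iUnion₂_subset fun i _ s hs => hs.2.trans (φ.grid_le t _))

/-- On the event that the integrand stays equal to its initial value up to time `t`, the Itô
integral up to time `t` is the initial value times `W t`. -/
lemma IsItoIntegral.eq_mul_of_const [IsProbabilityMeasure P] {W σ I : ℝ≥0 → Ω → ℝ}
    (hI : IsItoIntegral F P W σ I) (hW : IsWienerProcess F P W) (hσ : Measurable[F 0] (σ 0))
    (t : ℝ≥0) :
    ∀ᵐ ω ∂P, (∀ s ≤ t, σ s ω = σ 0 ω) → I t ω = σ 0 ω * W t ω := by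
  obtain ⟨φ, hφ⟩ := hI.limit
  obtain ⟨hφ1, hφ2⟩ := hφ t
  set A : Set Ω := {ω | ∀ s ≤ t, σ s ω = σ 0 ω} with hA
  have key : ∀ ε : ℝ, 0 < ε → P (A ∩ {ω | ε ≤ |I t ω - σ 0 ω * (W t ω - W 0 ω)|}) = 0 := by
    intro ε hε
    have hη : ∀ η : ℝ, 0 < η → P (A ∩ {ω | ε ≤ |I t ω - σ 0 ω * (W t ω - W 0 ω)|}) ≤
        ENNReal.ofReal (η / (ε / 2) ^ 2) := by
      intro η hη
      have hlim : Tendsto (fun k =>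
          P {ω | ENNReal.ofReal η ≤ ∫⁻ s in Iic t, ‖(φ k).val s ω - σ s ω‖ₑ ^ 2 ∂timeVolume}
          + P {ω | ENNReal.ofReal (ε / 2) ≤ edist ((φ k).integral W t ω) (I t ω)}
          + ENNReal.ofReal (η / (ε / 2) ^ 2)) atTop
          (𝓝 (0 + 0 + ENNReal.ofReal (η / (ε / 2) ^ 2))) :=
        ((hφ1 _ (ENNReal.ofReal_pos.2 hη)).add
          (hφ2 _ (ENNReal.ofReal_pos.2 (half_pos hε)))).add tendsto_const_nhds
      rw [zero_add, zero_add] at hlim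
      refine ge_of_tendsto' hlim fun k => ?_
      have hsub : A ∩ {ω | ε ≤ |I t ω - σ 0 ω * (W t ω - W 0 ω)|} ⊆
          ({ω | ENNReal.ofReal η ≤ ∫⁻ s in Iic t, ‖(φ k).val s ω - σ s ω‖ₑ ^ 2 ∂timeVolume} ∪
          {ω | ENNReal.ofReal (ε / 2) ≤ edist ((φ k).integral W t ω) (I t ω)}) ∪
          {ω | ∑ i ∈ Finset.range ((φ k).m + 2), (φ k).gridCoef t (σ 0) i ω ^ 2 *
              (((φ k).grid t (i + 1) : ℝ) - (φ k).grid t i) ≤ η ∧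
            ε / 2 ≤ |wienerSum W ((φ k).grid t) ((φ k).gridCoef t (σ 0)) ((φ k).m + 2) ω|} := by
        rintro ω ⟨hωA, hωε⟩
        by_contra hcon
        simp only [mem_union, not_or, mem_ofPred_eq, not_le, not_and] at hcon
        obtain ⟨⟨h1, h2⟩, h3⟩ := hcon
        have heq : ∫⁻ s in Iic t, ‖(φ k).val s ω - σ s ω‖ₑ ^ 2 ∂timeVolume =
            ∫⁻ s in Iic t, ‖(φ k).val s ω - σ 0 ω‖ₑ ^ 2 ∂timeVolume :=
          setLIntegral_congr_fun measurableSet_Iic fun s hs => by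
            simp only [hωA s hs]
        rw [heq] at h1
        have h4 := h3 (((ENNReal.ofReal_lt_ofReal_iff hη).1
          (((φ k).quadraticVariation_le t (σ 0) ω).trans_lt h1)).le)
        rw [SimpleIntegrand.wienerSum_grid] at h4
        rw [edist_dist, ENNReal.ofReal_lt_ofReal_iff (half_pos hε), Real.dist_eq, abs_sub_comm]
          at h2
        have hωε : ε ≤ |I t ω - σ 0 ω * (W t ω - W 0 ω)| := hωε
        have := abs_sub_le (I t ω) ((φ k).integral W t ω) (σ 0 ω * (W t ω - W 0 ω))
        linarith
      refine (measure_mono hsub).trans ((measure_union_le _ _).trans ?_)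
      exact add_le_add (measure_union_le _ _) (measure_wienerSum_ge_le hW ((φ k).grid_mono t)
        ((φ k).measurable_gridCoef t hσ) hη (half_pos hε) _)
    have hlim0 : Tendsto (fun η : ℝ => ENNReal.ofReal (η / (ε / 2) ^ 2)) (𝓝[>] 0) (𝓝 0) := by
      have h0 : Tendsto (fun η : ℝ => η / (ε / 2) ^ 2) (𝓝 0) (𝓝 0) := by
        simpa using (tendsto_id (α := ℝ) (x := 𝓝 0)).div_const ((ε / 2) ^ 2)
      have := ENNReal.tendsto_ofReal h0
      rw [ENNReal.ofReal_zero] at this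
      exact this.mono_left nhdsWithin_le_nhds
    exact le_antisymm (ge_of_tendsto hlim0 (eventually_nhdsWithin_of_forall fun η h => hη η h))
      zero_le
  have hall : ∀ᵐ ω ∂P, ∀ j : ℕ, ω ∉ A ∩ {ω | 1 / ((j : ℝ) + 1) ≤
      |I t ω - σ 0 ω * (W t ω - W 0 ω)|} :=
    ae_all_iff.2 fun j => measure_eq_zero_iff_ae_notMem.1 (key _ (by positivity))
  filter_upwards [hall, hW.isBrownian.eval_zero_ae_eq_zero] with ω h h0 hωA
  by_contra hne
  have hpos : 0 < |I t ω - σ 0 ω * (W t ω - W 0 ω)| := by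
    rw [h0, sub_zero]
    exact abs_pos.2 (sub_ne_zero.2 hne)
  obtain ⟨j, hj⟩ := exists_nat_one_div_lt hpos
  exact h j ⟨hωA, hj.le⟩

/-! ### The efficient price near time zero -/

/-- The integral of `f` against a purely atomic measure, up to a time, has no jumps only if `f`
vanishes on the atoms: the jump at time `t` is the value of `f` at the unique atom at time `t`.
Here `g` is the remaining, left-continuous part of the path. -/
lemma setIntegral_eq_zero_of_jump_eq_zero {μ : Measure (ℝ≥0 × ℝ)} {D : Set (ℝ≥0 × ℝ)}
    (hD : D.Countable) (hinj : InjOn Prod.fst D)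
    (hμ : μ = Measure.sum (fun z : D => Measure.dirac (z : ℝ≥0 × ℝ))) {f : ℝ≥0 × ℝ → ℝ}
    (hf : ∀ t : ℝ≥0, IntegrableOn f (Ioc 0 t ×ˢ univ) μ) {x g : ℝ≥0 → ℝ} {r : ℝ≥0}
    (hg : ∀ t < r, ContinuousWithinAt g (Iio t) t)
    (hx : ∀ t < r, x t = g t + ∫ z in Ioc 0 t ×ˢ univ, f z ∂μ)
    (hjump : ∀ t < r, jump x t = 0) {t : ℝ≥0} (ht : t < r) :
    ∫ z in Ioc 0 t ×ˢ univ, f z ∂μ = 0 := by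
  have : Countable D := hD.to_subtype
  have hmeas : ∀ s : ℝ≥0, MeasurableSet (Ioc 0 s ×ˢ (univ : Set ℝ)) := fun s =>
    measurableSet_Ioc.prod .univ
  have hzero : ∀ z ∈ D, 0 < z.1 → z.1 < r → f z = 0 := by
    intro z hz hz0 hzr
    set s := z.1 with hs
    -- the integral over the single time `s` is the value at the atom
    have hatom : ∫ y in {s} ×ˢ univ, f y ∂μ = f z := by
      have hres : μ.restrict ({s} ×ˢ univ) = Measure.dirac z := by
        have hms : MeasurableSet ({s} ×ˢ (univ : Set ℝ)) := (measurableSet_singleton s).prod .univ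
        rw [hμ, Measure.restrict_sum _ hms]
        ext B hB
        rw [Measure.sum_apply _ hB, tsum_eq_single ⟨z, hz⟩]
        · classical
          rw [restrict_dirac' hms, if_pos ⟨rfl, trivial⟩]
        · intro y hy
          classical
          rw [restrict_dirac' hms, if_neg]
          · simp
          · rintro ⟨h, -⟩
            exact hy (Subtype.ext (hinj y.2 hz h))
      rw [hres, integral_dirac]
    have hne : (𝓝[<] s).NeBot := nhdsLT_neBot_of_exists_lt ⟨0, hz0⟩
    have hlim : Tendsto (fun u => ∫ y in Ioc 0 u ×ˢ univ, f y ∂μ) (𝓝[<] s)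
        (𝓝 (∫ y in Ioo 0 s ×ˢ univ, f y ∂μ)) := by
      have hind : ∀ B ⊆ Ioc 0 s ×ˢ (univ : Set ℝ), MeasurableSet B →
          ∫ y in B, f y ∂μ = ∫ y in Ioc 0 s ×ˢ univ, B.indicator f y ∂μ := by
        intro B hB hBm
        rw [integral_indicator hBm, Measure.restrict_restrict hBm, inter_eq_left.2 hB]
      rw [hind _ (prod_mono Ioo_subset_Ioc_self subset_rfl) (measurableSet_Ioo.prod .univ)]
      have hev : ∀ᶠ u in 𝓝[<] s, ∫ y in Ioc 0 s ×ˢ univ,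
          (Ioc 0 u ×ˢ univ).indicator f y ∂μ = ∫ y in Ioc 0 u ×ˢ univ, f y ∂μ := by
        filter_upwards [self_mem_nhdsWithin] with u hu
        exact (hind _ (prod_mono (Ioc_subset_Ioc_right (le_of_lt hu)) subset_rfl) (hmeas u)).symm
      refine Tendsto.congr' hev ?_
      refine tendsto_integral_filter_of_dominated_convergence (fun y => ‖f y‖)
        (Eventually.of_forall fun u => (hf s).1.indicator (hmeas u))
        (Eventually.of_forall fun u => ae_of_all _ fun y => norm_indicator_le_norm_self _ _)
        (hf s).norm ?_
      refine ae_of_all _ fun y => tendsto_const_nhds.congr' ?_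
      by_cases hy : y.1 < s
      · filter_upwards [Ioo_mem_nhdsLT hy] with u hu
        simp only [indicator, mem_prod, mem_Ioo, mem_Ioc, hy, hu.1.le]
      · filter_upwards [self_mem_nhdsWithin] with u hu
        have : ¬ y.1 ≤ u := fun h => hy (h.trans_lt hu)
        simp [indicator, hy, this]
    have hx' : Tendsto x (𝓝[<] s) (𝓝 (g s + ∫ y in Ioo 0 s ×ˢ univ, f y ∂μ)) := by
      refine ((hg s hzr).tendsto.add hlim).congr' ?_
      filter_upwards [self_mem_nhdsWithin] with u hu
      exact (hx u (lt_trans hu hzr)).symm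
    have hj := hjump s hzr
    rw [jump, leftLim_eq_of_tendsto hx', hx s hzr] at hj
    have hsplit : ∫ y in Ioc 0 s ×ˢ univ, f y ∂μ =
        (∫ y in Ioo 0 s ×ˢ univ, f y ∂μ) + ∫ y in {s} ×ˢ univ, f y ∂μ := by
      have hU : Ioc 0 s ×ˢ (univ : Set ℝ) = Ioo 0 s ×ˢ univ ∪ {s} ×ˢ univ := by
        rw [← union_prod, Ioo_union_right hz0]
      have hI := hf s
      rw [hU] at hI ⊢
      refine setIntegral_union ?_ ((measurableSet_singleton s).prod .univ)
        (hI.mono_set subset_union_left) (hI.mono_set subset_union_right)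
      rw [Set.disjoint_prod]
      exact Or.inl (by simp)
    rw [hsplit, hatom] at hj
    linarith
  refine setIntegral_eq_zero_of_ae_eq_zero ?_
  rw [hμ, Measure.ae_sum_iff]
  intro z
  rw [ae_dirac_eq]
  exact fun hz => hzero z z.2 hz.1.1 (hz.1.2.trans_lt ht)

/-- Near time zero the efficient price is a Brownian motion with constant drift and volatility.
Only countably many times are considered, so that the exceptional null set of the Itô integral can
be chosen simultaneously. -/
lemma IsItoSemimartingale.eq_near_zero [IsProbabilityMeasure P] {W : ℝ≥0 → Ω → ℝ} {ν : Measure ℝ}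
    {N : Ω → Measure (ℝ≥0 × ℝ)} {b σ : ℝ≥0 → Ω → ℝ} {jumpSize : Ω → ℝ≥0 → ℝ → ℝ}
    {X : ℝ≥0 → Ω → ℝ} (hX : IsItoSemimartingale F P W ν N b σ jumpSize X)
    (hconst : ∀ᵐ ω ∂P, ∀ᶠ s in 𝓝 (0 : ℝ≥0),
      b s ω = b 0 ω ∧ σ s ω = σ 0 ω ∧ jump (fun u => X u ω) s = 0) :
    ∀ᵐ ω ∂P, ∃ r : ℝ, 0 < r ∧ ∀ n i : ℕ, (obsTime n i : ℝ) < r →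
      σ (obsTime n i) ω = σ 0 ω ∧
      X (obsTime n i) ω = X 0 ω + b 0 ω * obsTime n i + σ 0 ω * W (obsTime n i) ω := by
  obtain ⟨I, hI, hdec⟩ := hX.decomposition
  have hσ0 : Measurable[F 0] (σ 0) := hX.vol_prog.adapted 0
  have hIW : ∀ᵐ ω ∂P, ∀ n i : ℕ, (∀ s ≤ obsTime n i, σ s ω = σ 0 ω) →
      I (obsTime n i) ω = σ 0 ω * W (obsTime n i) ω :=
    ae_all_iff.2 fun n => ae_all_iff.2 fun i => hI.eq_mul_of_const hX.wiener hσ0 _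
  filter_upwards [hconst, hdec, hIW, hX.poisson.integer_valued, hX.jump_int, hI.continuous]
    with ω hc hd hiw hN hji hcont
  obtain ⟨D, hD, hinj, hμ⟩ := hN
  obtain ⟨r, hr, hball⟩ : ∃ r : ℝ≥0, 0 < r ∧ ∀ s < r,
      b s ω = b 0 ω ∧ σ s ω = σ 0 ω ∧ jump (fun u => X u ω) s = 0 := by
    obtain ⟨ε, hε, h⟩ := Metric.eventually_nhds_iff.1 hc
    refine ⟨⟨ε, hε.le⟩, hε, fun s hs => h ?_⟩
    have hs' : (s : ℝ) < ε := by exact_mod_cast hs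
    rw [NNReal.dist_eq]
    simpa using hs'
  have hdrift : ∀ t < r, ∫ s in Iic t, b s ω ∂timeVolume = b 0 ω * t := by
    intro t ht
    rw [setIntegral_congr_fun (g := fun _ => b 0 ω) measurableSet_Iic
      (fun s hs => (hball s (lt_of_le_of_lt hs ht)).1), setIntegral_const, measureReal_def,
      timeVolume_Iic, ENNReal.toReal_ofReal t.coe_nonneg, smul_eq_mul, mul_comm]
  have hjz : ∀ t < r, ∫ z in Ioc 0 t ×ˢ univ, jumpSize ω z.1 z.2 ∂(N ω) = 0 := by
    intro t ht
    refine setIntegral_eq_zero_of_jump_eq_zero (f := fun z => jumpSize ω z.1 z.2)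
      (x := fun u => X u ω) (g := fun u => X 0 ω + b 0 ω * u + I u ω)
      hD hinj hμ hji (fun u _ => ?_) (fun u hu => ?_) (fun u hu => (hball u hu).2.2) ht
    · exact Continuous.continuousWithinAt (by fun_prop)
    · rw [hd u, hdrift u hu]
  refine ⟨r, hr, fun n i hni => ?_⟩
  have hni' : obsTime n i < r := by exact_mod_cast hni
  refine ⟨(hball _ hni').2.1, ?_⟩
  rw [hd, hdrift _ hni', hjz _ hni',
    hiw n i fun s hs => (hball s (hs.trans_lt hni')).2.1, add_zero]

end

/-! ### Increments of the drift burst -/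

lemma burstIntegrable {ϑ : ℝ} (hϑ : ϑ < 1) (c τ τbar a b : ℝ) :
    IntervalIntegrable ((Icc τ τbar).indicator fun s => c * (s - τ) ^ (-ϑ)) volume a b := by
  have h : IntervalIntegrable (fun s : ℝ => c * (s - τ) ^ (-ϑ)) volume a b := by
    have := (intervalIntegral.intervalIntegrable_rpow' (a := a - τ) (b := b - τ)
      (show -1 < -ϑ by linarith)).comp_sub_right τ
    simp only [sub_add_cancel] at this
    exact this.const_mul c
  exact ⟨h.1.indicator measurableSet_Icc, h.2.indicator measurableSet_Icc⟩

/-- At a distance between `u` and `2 u` from the start of the burst, the increments of the burst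
are of the exact order `c u ^ (-ϑ)` times the length of the time interval. -/
lemma driftBurst_increment {c ϑ τ τbar u : ℝ} (hϑ0 : 0 < ϑ) (hϑ1 : ϑ < 1) (hu : 0 < u)
    {s t : ℝ≥0} (hst : s ≤ t) (hs : τ + u ≤ s) (ht : (t : ℝ) ≤ τ + 2 * u) (htb : τ + 2 * u ≤ τbar) :
    ∃ h : ℝ, driftBurst c ϑ τ τbar t - driftBurst c ϑ τ τbar s = c * h ∧
      ((t : ℝ) - s) * u ^ (-ϑ) / 2 ≤ h ∧ h ≤ ((t : ℝ) - s) * u ^ (-ϑ) := by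
  have hst' : (s : ℝ) ≤ t := by exact_mod_cast hst
  have hII := fun a b => burstIntegrable hϑ1 c τ τbar a b
  have hpos : ∀ x ∈ Icc (s : ℝ) t, u ≤ x - τ ∧ x - τ ≤ 2 * u := fun x hx =>
    ⟨by linarith [hx.1], by linarith [hx.2]⟩
  have hcont : ContinuousOn (fun x : ℝ => (x - τ) ^ (-ϑ)) (Icc (s : ℝ) t) :=
    ContinuousOn.rpow_const (by fun_prop) fun x hx => Or.inl (by linarith [(hpos x hx).1])
  have hI : IntervalIntegrable (fun x : ℝ => (x - τ) ^ (-ϑ)) volume s t :=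
    ContinuousOn.intervalIntegrable (by rwa [uIcc_of_le hst'])
  refine ⟨∫ x in (s : ℝ)..t, (x - τ) ^ (-ϑ), ?_, ?_, ?_⟩
  · rw [driftBurst, driftBurst, intervalIntegral.integral_interval_sub_left (hII _ _) (hII _ _),
      ← intervalIntegral.integral_const_mul]
    refine intervalIntegral.integral_congr fun x hx => ?_
    rw [uIcc_of_le hst'] at hx
    have := hpos x hx
    have hmem : x ∈ Icc τ τbar := ⟨by linarith, by linarith⟩
    simp only [indicator_of_mem hmem]
  · have hb : ∀ x ∈ Icc (s : ℝ) t, u ^ (-ϑ) / 2 ≤ (x - τ) ^ (-ϑ) := by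
      intro x hx
      have h1 : (2 * u) ^ (-ϑ) ≤ (x - τ) ^ (-ϑ) :=
        Real.rpow_le_rpow_of_nonpos (by linarith [(hpos x hx).1]) (hpos x hx).2 (by linarith)
      have h2 : (2 : ℝ) ^ (-1 : ℝ) ≤ 2 ^ (-ϑ) :=
        Real.rpow_le_rpow_of_exponent_le (by norm_num) (by linarith)
      rw [Real.rpow_neg_one] at h2
      rw [Real.mul_rpow (by norm_num) hu.le] at h1
      have h3 := mul_le_mul_of_nonneg_right h2 (Real.rpow_nonneg hu.le (-ϑ))
      linarith
    have := intervalIntegral.integral_mono_on hst' intervalIntegrable_const hI hb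
    rw [intervalIntegral.integral_const, smul_eq_mul] at this
    linarith
  · have hb : ∀ x ∈ Icc (s : ℝ) t, (x - τ) ^ (-ϑ) ≤ u ^ (-ϑ) := fun x hx =>
      Real.rpow_le_rpow_of_nonpos hu (hpos x hx).1 (by linarith)
    have := intervalIntegral.integral_mono_on hst' hI intervalIntegrable_const hb
    rwa [intervalIntegral.integral_const, smul_eq_mul] at this

/-! ### The signal dominates the noise -/

/-- The constant in the bound for the error of volatility estimation in `estimate_lower_bound`. -/
def errorConst (c R : ℝ) : ℝ := R ^ 3 * √(3 * (R ^ 2 + R ^ 3 + c ^ 2))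

/-- A sum of increments `y = b d + σ g + c h`, rescaled by estimates `s` of `σ`, is at least of the
order of the signal `c h`, which exceeds `√d` by a factor `M`. The bounds on `∑ g ^ 2` and
`∑ (s - σ) ^ 2` enter through the Cauchy-Schwarz inequality. -/
lemma estimate_lower_bound {ι : Type*} (S : Finset ι) {R M d b σ c l δ : ℝ} {y g h s : ι → ℝ}
    (hR : 1 ≤ R) (hM : 1 ≤ M) (hd : 0 < d) (hd1 : d ≤ 1) (hl : 0 < l) (hδ : 0 < δ)
    (hb : |b| ≤ R) (hσ1 : 1 / R ≤ σ) (hσ2 : σ ≤ R)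
    (hy : ∀ i ∈ S, y i = b * d + σ * g i + c * h i)
    (hh1 : ∀ i ∈ S, √d * M / 2 ≤ h i) (hh2 : ∀ i ∈ S, h i ≤ √d * M)
    (hg : ∑ i ∈ S, g i ^ 2 ≤ R * (S.card * d))
    (hs : ∀ i ∈ S, 1 / R / l ≤ s i)
    (he : ∑ i ∈ S, (s i - σ) ^ 2 ≤ R ^ 2 * (S.card * δ ^ 2)) :
    S.card * √d * (M * |c| / (2 * R) - R ^ 2 - √R - errorConst c R * (l * δ) * M) ≤
      |∑ i ∈ S, y i / s i| := by
  have hR0 : 0 < R := by linarith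
  have hσ0 : 0 < σ := lt_of_lt_of_le (by positivity) hσ1
  have hs0 : ∀ i ∈ S, 0 < s i := fun i hi => lt_of_lt_of_le (by positivity) (hs i hi)
  have hsd : d ≤ √d := Real.le_sqrt_of_sq_le (by nlinarith)
  have hsq : √d ^ 2 = d := Real.sq_sqrt hd.le
  have hsd0 : 0 < √d := Real.sqrt_pos.2 hd
  set v : ℝ := (S.card : ℝ) with hv
  have hv0 : 0 ≤ v := Nat.cast_nonneg _
  have hσinv : 1 / σ ≤ R := by
    rw [div_le_iff₀ hσ0]
    rw [div_le_iff₀ hR0] at hσ1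
    linarith
  have hsinv : ∀ i ∈ S, 1 / s i ≤ R * l := by
    intro i hi
    have := hs i hi
    rw [div_div, div_le_iff₀ (by positivity)] at this
    rw [div_le_iff₀ (hs0 i hi)]
    linarith
  -- signal, drift, Brownian part and the error from estimating `σ`
  have hdecomp : ∑ i ∈ S, y i / s i = c * (∑ i ∈ S, h i) / σ + b * d * v / σ + ∑ i ∈ S, g i
      + ∑ i ∈ S, y i * (1 / s i - 1 / σ) := by
    have h1 : ∀ i ∈ S, y i / s i = c * h i / σ + b * d / σ + g i + y i * (1 / s i - 1 / σ) := by
      intro i hi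
      have := (hs0 i hi).ne'
      rw [hy i hi]
      field_simp
      ring
    rw [Finset.sum_congr rfl h1, Finset.sum_add_distrib, Finset.sum_add_distrib,
      Finset.sum_add_distrib, Finset.sum_const, nsmul_eq_mul, ← Finset.sum_div, Finset.mul_sum]
    ring
  have hsig : v * √d * (M * |c| / (2 * R)) ≤ |c * (∑ i ∈ S, h i) / σ| := by
    have hsum : v * (√d * M / 2) ≤ ∑ i ∈ S, h i := by
      have := Finset.card_nsmul_le_sum S h _ hh1
      rwa [nsmul_eq_mul] at this
    have hsum0 : 0 ≤ ∑ i ∈ S, h i := le_trans (by positivity) hsum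
    rw [abs_div, abs_mul, abs_of_nonneg hsum0, abs_of_pos hσ0]
    calc v * √d * (M * |c| / (2 * R)) = |c| * (v * (√d * M / 2)) / R := by ring
      _ ≤ |c| * (∑ i ∈ S, h i) / σ := by gcongr
  have hdrift : |b * d * v / σ| ≤ v * √d * R ^ 2 := by
    rw [abs_div, abs_mul, abs_mul, abs_of_pos hσ0, abs_of_pos hd, abs_of_nonneg hv0]
    calc |b| * d * v / σ = |b| * d * v * (1 / σ) := by ring
      _ ≤ R * √d * v * R := by gcongr
      _ = v * √d * R ^ 2 := by ring
  have hbm : |∑ i ∈ S, g i| ≤ v * √d * √R := by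
    refine abs_le_of_sq_le_sq ?_ (by positivity)
    have h1 := sq_sum_le_card_mul_sum_sq (s := S) (f := g)
    calc (∑ i ∈ S, g i) ^ 2 ≤ v * ∑ i ∈ S, g i ^ 2 := h1
      _ ≤ v * (R * (v * d)) := by gcongr
      _ = (v * √d * √R) ^ 2 := by
        rw [mul_pow, mul_pow, hsq, Real.sq_sqrt hR0.le]
        ring
  have herr : |∑ i ∈ S, y i * (1 / s i - 1 / σ)| ≤ v * √d * (errorConst c R * (l * δ) * M) := by
    have hy2 : ∑ i ∈ S, y i ^ 2 ≤ 3 * (R ^ 2 + R ^ 3 + c ^ 2) * (v * d * M ^ 2) := by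
      have h1 : ∀ i ∈ S, y i ^ 2 ≤ 3 * (R ^ 2 * d) + 3 * (R ^ 2 * g i ^ 2)
          + 3 * (c ^ 2 * (d * M ^ 2)) := by
        intro i hi
        have hb2 : b ^ 2 ≤ R ^ 2 := sq_le_sq.2 (by rwa [abs_of_pos hR0])
        have hσ22 : σ ^ 2 ≤ R ^ 2 := pow_le_pow_left₀ hσ0.le hσ2 2
        have hh : h i ^ 2 ≤ d * M ^ 2 := by
          have h0 : 0 ≤ h i := le_trans (by positivity) (hh1 i hi)
          have := pow_le_pow_left₀ h0 (hh2 i hi) 2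
          rwa [mul_pow, hsq] at this
        have h3 : (b * d) ^ 2 ≤ R ^ 2 * d := by
          rw [mul_pow]
          have : d ^ 2 ≤ d := by nlinarith
          gcongr
        have h4 : (σ * g i) ^ 2 ≤ R ^ 2 * g i ^ 2 := by
          rw [mul_pow]; gcongr
        have h5 : (c * h i) ^ 2 ≤ c ^ 2 * (d * M ^ 2) := by
          rw [mul_pow]; gcongr
        rw [hy i hi]
        nlinarith [sq_nonneg (b * d - σ * g i), sq_nonneg (b * d - c * h i),
          sq_nonneg (σ * g i - c * h i)]
      refine (Finset.sum_le_sum h1).trans ?_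
      rw [Finset.sum_add_distrib, Finset.sum_add_distrib, Finset.sum_const, Finset.sum_const,
        nsmul_eq_mul, nsmul_eq_mul, ← Finset.mul_sum, ← Finset.mul_sum]
      have hM2 : 1 ≤ M ^ 2 := one_le_pow₀ hM
      have hvd : v * d ≤ v * d * M ^ 2 := le_mul_of_one_le_right (by positivity) hM2
      have h2 : R ^ 2 * ∑ i ∈ S, g i ^ 2 ≤ R ^ 3 * (v * d * M ^ 2) := by
        calc R ^ 2 * ∑ i ∈ S, g i ^ 2 ≤ R ^ 2 * (R * (v * d)) := by gcongr
          _ = R ^ 3 * (v * d) := by ring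
          _ ≤ _ := by gcongr
      have h3 : R ^ 2 * (v * d) ≤ R ^ 2 * (v * d * M ^ 2) := by gcongr
      linarith
    have hab : |∑ i ∈ S, y i * (1 / s i - 1 / σ)| ≤
        R ^ 2 * l * ∑ i ∈ S, |y i| * |s i - σ| := by
      refine (Finset.abs_sum_le_sum_abs _ _).trans ?_
      rw [Finset.mul_sum]
      refine Finset.sum_le_sum fun i hi => ?_
      have hsi := hs0 i hi
      have : 1 / s i - 1 / σ = -((s i - σ) * (1 / s i * (1 / σ))) := by
        field_simp
        ring
      rw [this, abs_mul, abs_neg, abs_mul, abs_of_pos (show 0 < 1 / s i * (1 / σ) by positivity)]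
      calc |y i| * (|s i - σ| * (1 / s i * (1 / σ)))
          ≤ |y i| * (|s i - σ| * (R * l * R)) := by
            gcongr
            exact hsinv i hi
        _ = R ^ 2 * l * (|y i| * |s i - σ|) := by ring
    have hcs : ∑ i ∈ S, |y i| * |s i - σ| ≤
        √(3 * (R ^ 2 + R ^ 3 + c ^ 2)) * (R * v * √d * M * δ) := by
      refine abs_le_of_sq_le_sq' ?_ (by positivity) |>.2
      have h1 := Finset.sum_mul_sq_le_sq_mul_sq S (fun i => |y i|) (fun i => |s i - σ|)
      simp only [sq_abs] at h1
      calc (∑ i ∈ S, |y i| * |s i - σ|) ^ 2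
          ≤ (∑ i ∈ S, y i ^ 2) * ∑ i ∈ S, (s i - σ) ^ 2 := h1
        _ ≤ (3 * (R ^ 2 + R ^ 3 + c ^ 2) * (v * d * M ^ 2)) * (R ^ 2 * (v * δ ^ 2)) := by
          refine mul_le_mul hy2 he (Finset.sum_nonneg fun i _ => sq_nonneg _) (by positivity)
        _ = _ := by
          rw [mul_pow, Real.sq_sqrt (by positivity), mul_pow, mul_pow, mul_pow, mul_pow, hsq]
          ring
    calc _ ≤ R ^ 2 * l * (√(3 * (R ^ 2 + R ^ 3 + c ^ 2)) * (R * v * √d * M * δ)) :=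
          hab.trans (by gcongr)
      _ = _ := by
        unfold errorConst
        ring
  rw [hdecomp]
  have t1 := abs_add_le (c * (∑ i ∈ S, h i) / σ + b * d * v / σ + ∑ i ∈ S, g i
      + ∑ i ∈ S, y i * (1 / s i - 1 / σ))
    (-(b * d * v / σ + ∑ i ∈ S, g i + ∑ i ∈ S, y i * (1 / s i - 1 / σ)))
  have t2 := abs_add_three (b * d * v / σ) (∑ i ∈ S, g i) (∑ i ∈ S, y i * (1 / s i - 1 / σ))
  rw [abs_neg] at t1
  have t3 : c * (∑ i ∈ S, h i) / σ + b * d * v / σ + ∑ i ∈ S, g i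
      + ∑ i ∈ S, y i * (1 / s i - 1 / σ)
      + -(b * d * v / σ + ∑ i ∈ S, g i + ∑ i ∈ S, y i * (1 / s i - 1 / σ)) =
      c * (∑ i ∈ S, h i) / σ := by ring
  rw [t3] at t1
  linarith

/-! ### Asymptotics of the mesh, the window and the delay -/

lemma tendsto_mesh : Tendsto mesh atTop (𝓝[>] 0) := by
  refine tendsto_nhdsWithin_iff.2 ⟨tendsto_one_div_atTop_nhds_zero_nat, ?_⟩
  filter_upwards [eventually_gt_atTop 0] with n hn
  have : (0 : ℝ) < n := Nat.cast_pos.2 hn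
  exact one_div_pos.2 this

lemma tendsto_mesh_rpow {p : ℝ} (hp : 0 < p) :
    Tendsto (fun n => mesh n ^ p) atTop (𝓝 0) := by
  have h := (Real.continuousAt_rpow_const 0 p (Or.inr hp.le)).tendsto
  rw [Real.zero_rpow hp.ne'] at h
  exact h.comp (tendsto_mesh.mono_right nhdsWithin_le_nhds)

lemma tendsto_mesh_rpow_atTop {p : ℝ} (hp : p < 0) :
    Tendsto (fun n => mesh n ^ p) atTop atTop := by
  have h := (tendsto_rpow_atTop (neg_pos.2 hp)).comp tendsto_natCast_atTop_atTop
  refine h.congr fun n => ?_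
  simp only [Function.comp, mesh]
  rw [one_div, Real.inv_rpow (Nat.cast_nonneg n), Real.rpow_neg (Nat.cast_nonneg n)]

lemma eventually_mesh_pos : ∀ᶠ n in atTop, 0 < mesh n :=
  tendsto_mesh.eventually self_mem_nhdsWithin

/-- The length of the window used for detection: of order `ξ ^ 2`, but at most `w`. -/
def window (w : ℕ → ℕ) (ξ : ℕ → ℝ) (n : ℕ) : ℕ := min (w n) ⌈ξ n ^ 2⌉₊

lemma window_mul_mesh_rpow {w : ℕ → ℕ} {ξ : ℕ → ℝ}
    (hξ : ∀ ι : ℝ, 0 < ι → Tendsto (fun n => ξ n * mesh n ^ ι) atTop (𝓝 0)) {p : ℝ} (hp : 0 < p) :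
    Tendsto (fun n => (window w ξ n : ℝ) * mesh n ^ p) atTop (𝓝 0) := by
  have h1 : Tendsto (fun n => (ξ n * mesh n ^ (p / 2)) ^ 2 + mesh n ^ p) atTop (𝓝 (0 ^ 2 + 0)) :=
    ((hξ (p / 2) (half_pos hp)).pow 2).add (tendsto_mesh_rpow hp)
  norm_num at h1
  refine tendsto_of_tendsto_of_tendsto_of_le_of_le' tendsto_const_nhds h1 ?_ ?_
  · filter_upwards [eventually_mesh_pos] with n hn
    positivity
  · filter_upwards [eventually_mesh_pos] with n hn
    have h2 : (window w ξ n : ℝ) ≤ ξ n ^ 2 + 1 := by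
      have h3 : (window w ξ n : ℝ) ≤ (⌈ξ n ^ 2⌉₊ : ℝ) := by exact_mod_cast min_le_right _ _
      exact h3.trans (Nat.ceil_lt_add_one (sq_nonneg _)).le
    have h4 : (mesh n ^ (p / 2)) ^ 2 = mesh n ^ p := by
      rw [← Real.rpow_natCast, ← Real.rpow_mul hn.le]
      norm_num
    rw [mul_pow, h4]
    have := Real.rpow_nonneg hn.le p
    nlinarith

/-- The window is at least of the order `ξ ^ 2`, because `w` is. -/
lemma window_lower_bound {c : ℝ} (hc : c ≠ 0) {w : ℕ → ℕ} {ξ : ℕ → ℝ} (hξ_pos : ∀ n, 0 < ξ n)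
    {a : ℕ → ℝ} {aLim : EReal}
    (ha : Tendsto (fun n => (a n : EReal)) atTop (𝓝 aLim))
    (haLim : ((2 / c ^ 2 : ℝ) : EReal) < aLim)
    (hw : Tendsto (fun n => (w n : ℝ) / (a n * ξ n ^ 2)) atTop (𝓝 1)) :
    ∀ᶠ n in atTop, 1 ≤ window w ξ n ∧ ξ n ^ 2 ≤ max 1 (c ^ 2) * window w ξ n := by
  have hc2 : 0 < c ^ 2 := by positivity
  filter_upwards [ha.eventually_const_lt haLim,
    hw.eventually_const_lt (show (1 / 2 : ℝ) < 1 by norm_num)] with n h1 h2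
  have h1' : 2 / c ^ 2 < a n := by exact_mod_cast h1
  have hξn := hξ_pos n
  have han : 0 < a n := lt_trans (by positivity) h1'
  have hwξ : ξ n ^ 2 ≤ c ^ 2 * w n := by
    rw [lt_div_iff₀ (by positivity)] at h2
    rw [div_lt_iff₀ hc2] at h1'
    have : ξ n ^ 2 * 2 ≤ ξ n ^ 2 * (a n * c ^ 2) := by gcongr
    nlinarith
  have hξ2 : 0 < ξ n ^ 2 := by positivity
  have hw1 : 1 ≤ w n := by
    by_contra h
    have : w n = 0 := by omega
    rw [this] at hwξ
    norm_num at hwξ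
    linarith
  refine ⟨le_min hw1 (Nat.ceil_pos.2 hξ2), ?_⟩
  rcases min_choice (w n) ⌈ξ n ^ 2⌉₊ with h | h
  · rw [window, h]
    exact hwξ.trans (by gcongr; exact le_max_right _ _)
  · rw [window, h]
    refine (Nat.le_ceil _).trans ?_
    exact le_mul_of_one_le_left (Nat.cast_nonneg _) (le_max_left _ _)

lemma tendsto_logRate_mul {δ : ℕ → ℝ} (hδ : ∀ n, 0 < δ n) (hδ0 : Tendsto δ atTop (𝓝 0)) :
    Tendsto (fun n => logRate δ n * δ n) atTop (𝓝 0) := by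
  have h : Tendsto δ atTop (𝓝[>] 0) :=
    tendsto_nhdsWithin_iff.2 ⟨hδ0, Eventually.of_forall hδ⟩
  have h1 := ((tendsto_log_mul_rpow_nhdsGT_zero zero_lt_one).comp h).neg
  rw [neg_zero] at h1
  refine h1.congr fun n => ?_
  simp [logRate, Real.log_inv]

/-- An exponent `β`, such that at the time `mesh ^ (β / ϑ)` after the start of the burst the
increments of the burst, of order `mesh ^ (1 - β)`, exceed the Brownian increments but not the
truncation level, and such that this time is longer than a window but shorter than the delay. -/
structure IsBurstExponent (ϑ ϖ β : ℝ) : Prop where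
  half_lt : 1 / 2 < β
  lt_theta : β < ϑ
  lt_trunc : β < 1 - ϖ

lemma exists_isBurstExponent {ϑ ϖ : ℝ} (hϑ : 1 / 2 < ϑ) (hϖ : ϖ < 1 / 2) :
    ∃ β, IsBurstExponent ϑ ϖ β := by
  obtain ⟨β, h1, h2⟩ := exists_between (lt_min hϑ (show 1 / 2 < 1 - ϖ by linarith))
  exact ⟨β, h1, (lt_min_iff.1 h2).1, (lt_min_iff.1 h2).2⟩

/-- The time after the start of the burst at which it is detected. -/
def burstLag (ϑ β : ℝ) (n : ℕ) : ℝ := mesh n ^ (β / ϑ)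

/-- The size of the increments of the burst at the time of detection, relative to the size
`√mesh` of the Brownian increments. -/
def burstRatio (β : ℝ) (n : ℕ) : ℝ := mesh n ^ (1 / 2 - β)

section

variable {ϑ ϖ β : ℝ}

lemma IsBurstExponent.tendsto_burstLag (hβ : IsBurstExponent ϑ ϖ β) :
    Tendsto (burstLag ϑ β) atTop (𝓝 0) :=
  tendsto_mesh_rpow (div_pos (by linarith [hβ.half_lt]) (by linarith [hβ.half_lt, hβ.lt_theta]))

lemma IsBurstExponent.mesh_mul_burstLag (hβ : IsBurstExponent ϑ ϖ β) {n : ℕ} (hn : 0 < mesh n) :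
    mesh n * burstLag ϑ β n ^ (-ϑ) = √(mesh n) * burstRatio β n := by
  have hϑ : ϑ ≠ 0 := by linarith [hβ.half_lt, hβ.lt_theta]
  rw [burstLag, burstRatio, ← Real.rpow_mul hn.le, Real.sqrt_eq_rpow, ← Real.rpow_add hn]
  nth_rw 1 [← Real.rpow_one (mesh n)]
  rw [← Real.rpow_add hn]
  congr 1
  field_simp
  ring

lemma IsBurstExponent.window_le (hβ : IsBurstExponent ϑ ϖ β) {w : ℕ → ℕ} {ξ : ℕ → ℝ}
    (hξ : ∀ ι : ℝ, 0 < ι → Tendsto (fun n => ξ n * mesh n ^ ι) atTop (𝓝 0)) :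
    ∀ᶠ n in atTop, ((window w ξ n : ℝ) + 1) * mesh n ≤ burstLag ϑ β n := by
  have hϑ : 0 < ϑ := by linarith [hβ.half_lt, hβ.lt_theta]
  have hp : 0 < 1 - β / ϑ := by
    rw [sub_pos, div_lt_one hϑ]
    exact hβ.lt_theta
  have h := (window_mul_mesh_rpow (w := w) hξ hp).add (tendsto_mesh_rpow hp)
  rw [add_zero] at h
  filter_upwards [h.eventually_le_const zero_lt_one, eventually_mesh_pos] with n h1 hn
  rw [← add_one_mul, Real.rpow_sub hn, Real.rpow_one, ← mul_div_assoc,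
    div_le_one (Real.rpow_pos_of_pos hn _)] at h1
  exact h1

lemma IsBurstExponent.two_mul_burstLag_le (hβ : IsBurstExponent ϑ ϖ β) {T : ℕ → ℝ}
    (hT : Tendsto (fun n => T n / mesh n ^ ((1 / 2 - ϑ) / ϑ)) atTop atTop) :
    ∀ᶠ n in atTop, 2 * burstLag ϑ β n ≤ T n * mesh n := by
  have hϑ : 0 < ϑ := by linarith [hβ.half_lt, hβ.lt_theta]
  have hp : 0 < β / ϑ - (1 / 2) / ϑ := by
    rw [← sub_div]
    exact div_pos (by linarith [hβ.half_lt]) hϑ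
  filter_upwards [hT.eventually_ge_atTop 1, eventually_mesh_pos,
    (tendsto_mesh_rpow hp).eventually_le_const (show (0 : ℝ) < 1 / 2 by norm_num)] with n h1 hn h2
  have h3 : burstLag ϑ β n =
      mesh n ^ (β / ϑ - (1 / 2) / ϑ) * mesh n ^ ((1 / 2 - ϑ) / ϑ) * mesh n := by
    nth_rw 3 [← Real.rpow_one (mesh n)]
    rw [← Real.rpow_add hn, ← Real.rpow_add hn, burstLag]
    congr 1
    field_simp
    ring
  have hpos := Real.rpow_pos_of_pos hn ((1 / 2 - ϑ) / ϑ)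
  rw [le_div_iff₀ hpos, one_mul] at h1
  rw [h3]
  have : mesh n ^ (β / ϑ - (1 / 2) / ϑ) * mesh n ^ ((1 / 2 - ϑ) / ϑ) ≤ 1 / 2 * T n := by gcongr
  nlinarith

lemma IsBurstExponent.tendsto_burstRatio (hβ : IsBurstExponent ϑ ϖ β) :
    Tendsto (burstRatio β) atTop atTop :=
  tendsto_mesh_rpow_atTop (by linarith [hβ.half_lt])

/-- No increment in the window is truncated: the left side bounds the increments of the price. -/
lemma IsBurstExponent.increment_lt_truncation (hβ : IsBurstExponent ϑ ϖ β)
    (hϖ : ϖ < 1 / 2) {ζ : ℝ} (hζ : 0 < ζ)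
    {w : ℕ → ℕ} {ξ : ℕ → ℝ}
    (hξ : ∀ ι : ℝ, 0 < ι → Tendsto (fun n => ξ n * mesh n ^ ι) atTop (𝓝 0)) (c R : ℝ) :
    ∀ᶠ n in atTop, R * mesh n + R * √(R * (window w ξ n * mesh n))
      + |c| * (√(mesh n) * burstRatio β n) < ζ * mesh n ^ ϖ := by
  have h1 : Tendsto (fun n => R * mesh n ^ (1 - ϖ)) atTop (𝓝 0) := by
    simpa using (tendsto_mesh_rpow (p := 1 - ϖ) (by linarith)).const_mul R
  have h2 : Tendsto (fun n => R * √(R * (window w ξ n * mesh n ^ (1 - 2 * ϖ)))) atTop (𝓝 0) := by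
    have h := ((window_mul_mesh_rpow (w := w) hξ (p := 1 - 2 * ϖ) (by linarith)).const_mul R).sqrt
    simpa using h.const_mul R
  have h3 : Tendsto (fun n => |c| * mesh n ^ (1 - β - ϖ)) atTop (𝓝 0) := by
    simpa using (tendsto_mesh_rpow (p := 1 - β - ϖ) (by linarith [hβ.lt_trunc])).const_mul |c|
  have h := (h1.add h2).add h3
  rw [add_zero, add_zero] at h
  filter_upwards [h.eventually_lt_const hζ, eventually_mesh_pos] with n hlt hn
  have hp := Real.rpow_pos_of_pos hn ϖ
  have e1 : mesh n = mesh n ^ (1 - ϖ) * mesh n ^ ϖ := by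
    rw [← Real.rpow_add hn]
    simp
  have e2 : √(R * (window w ξ n * mesh n)) =
      √(R * (window w ξ n * mesh n ^ (1 - 2 * ϖ))) * mesh n ^ ϖ := by
    have : R * (window w ξ n * mesh n) =
        R * (window w ξ n * mesh n ^ (1 - 2 * ϖ)) * (mesh n ^ ϖ) ^ 2 := by
      have : mesh n = mesh n ^ (1 - 2 * ϖ) * (mesh n ^ ϖ) ^ 2 := by
        rw [← Real.rpow_natCast, ← Real.rpow_mul hn.le, ← Real.rpow_add hn]
        norm_num
        ring_nf
        simp
      linear_combination R * window w ξ n * this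
    rw [this, Real.sqrt_mul' _ (sq_nonneg _), Real.sqrt_sq hp.le]
  have e3 : √(mesh n) * burstRatio β n = mesh n ^ (1 - β - ϖ) * mesh n ^ ϖ := by
    rw [burstRatio, Real.sqrt_eq_rpow, ← Real.rpow_add hn, ← Real.rpow_add hn]
    congr 1
    ring
  calc R * mesh n + R * √(R * (window w ξ n * mesh n)) + |c| * (√(mesh n) * burstRatio β n)
      = (R * mesh n ^ (1 - ϖ) + R * √(R * (window w ξ n * mesh n ^ (1 - 2 * ϖ)))
        + |c| * mesh n ^ (1 - β - ϖ)) * mesh n ^ ϖ := by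
        rw [e2, e3]
        nth_rw 1 [e1]
        ring
    _ < ζ * mesh n ^ ϖ := by gcongr

/-- The signal beats the threshold, since the ratio of the burst to the noise diverges while
`ξ` is at most of the order of the square root of the window. -/
lemma IsBurstExponent.threshold_lt (hβ : IsBurstExponent ϑ ϖ β) {c : ℝ} (hc : c ≠ 0) {w : ℕ → ℕ}
    {ξ : ℕ → ℝ} (hξ_pos : ∀ n, 0 < ξ n) {a : ℕ → ℝ} {aLim : EReal}
    (ha : Tendsto (fun n => (a n : EReal)) atTop (𝓝 aLim))
    (haLim : ((2 / c ^ 2 : ℝ) : EReal) < aLim)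
    (hw : Tendsto (fun n => (w n : ℝ) / (a n * ξ n ^ 2)) atTop (𝓝 1))
    {δ : ℕ → ℝ} (hδ : ∀ n, 0 < δ n) (hδ0 : Tendsto δ atTop (𝓝 0)) {R : ℝ} (hR : 0 < R) :
    ∀ᶠ n in atTop, ξ n < √(window w ξ n) * (burstRatio β n * |c| / (2 * R) - R ^ 2 - √R
      - errorConst c R * (logRate δ n * δ n) * burstRatio β n) := by
  have h1 : Tendsto (fun n => |c| / (2 * R) - errorConst c R * (logRate δ n * δ n)) atTop
      (𝓝 (|c| / (2 * R))) := by
    simpa using ((tendsto_logRate_mul hδ hδ0).const_mul (errorConst c R)).const_sub (|c| / (2 * R))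
  have h2 := hβ.tendsto_burstRatio.atTop_mul_pos
    (show 0 < |c| / (2 * R) by have := abs_pos.2 hc; positivity) h1
  filter_upwards [h2.eventually_gt_atTop (√(max 1 (c ^ 2)) + R ^ 2 + √R),
    window_lower_bound hc hξ_pos ha haLim hw] with n h3 ⟨h4, h5⟩
  have hv : 0 < √(window w ξ n : ℝ) := Real.sqrt_pos.2 (by exact_mod_cast h4)
  have h6 : ξ n ≤ √(window w ξ n) * √(max 1 (c ^ 2)) := by
    rw [← Real.sqrt_mul (Nat.cast_nonneg _), mul_comm]
    exact Real.le_sqrt_of_sq_le h5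
  refine h6.trans_lt (mul_lt_mul_of_pos_left ?_ hv)
  have : burstRatio β n * (|c| / (2 * R) - errorConst c R * (logRate δ n * δ n)) =
    burstRatio β n * |c| / (2 * R) - errorConst c R * (logRate δ n * δ n) * burstRatio β n := by
    ring
  linarith

end

/-! ### Detection along a single path -/

lemma coe_obsTime (n i : ℕ) : (obsTime n i : ℝ) = i * mesh n := by
  simp [obsTime, mesh, div_eq_mul_inv]

lemma obsTime_mono (n : ℕ) : Monotone (obsTime n) := fun i j h => by
  unfold obsTime
  gcongr

lemma coe_obsTime_sub {n i : ℕ} (hi : 1 ≤ i) :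
    (obsTime n i : ℝ) - obsTime n (i - 1) = mesh n := by
  rw [coe_obsTime, coe_obsTime, Nat.cast_sub hi]
  push_cast
  ring

/-- If in the window `(k, k + v]` the burst is strong, the efficient price is a Brownian motion
with drift, and the noise and the estimation errors have their typical size, then the detector
stops not later than at the end of the window. -/
lemma detector_le_of_window {n w k v : ℕ} {x W s : ℝ≥0 → ℝ}
    {horizon ζ ϖ ξ c ϑ τ τbar u R M b σ x0 l δ : ℝ}
    (hn : 0 < mesh n) (hn1 : mesh n ≤ 1) (hv1 : 1 ≤ v) (hvw : v ≤ w)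
    (hϑ0 : 0 < ϑ) (hϑ1 : ϑ < 1) (hu : 0 < u)
    (huM : mesh n * u ^ (-ϑ) = √(mesh n) * M) (hR : 1 ≤ R) (hM : 1 ≤ M) (hl : 0 < l) (hδ : 0 < δ)
    (hk1 : τ + u ≤ obsTime n k) (hk2 : (obsTime n (k + v) : ℝ) ≤ τ + 2 * u)
    (htb : τ + 2 * u ≤ τbar) (hth : τ + 2 * u ≤ horizon)
    (hx : ∀ i, k ≤ i → i ≤ k + v →
      x (obsTime n i) = x0 + b * obsTime n i + σ * W (obsTime n i))
    (hb : |b| ≤ R) (hσ1 : 1 / R ≤ σ) (hσ2 : σ ≤ R)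
    (hg : ∑ i ∈ Finset.Ioc k (k + v), increment n i W ^ 2 ≤ R * (v * mesh n))
    (hs : ∀ i, k ≤ i → i < k + v → 1 / R / l ≤ s (obsTime n i))
    (he : ∑ i ∈ Finset.Ioc k (k + v), (s (obsTime n (i - 1)) - σ) ^ 2 ≤ R ^ 2 * (v * δ ^ 2))
    (htrunc : R * mesh n + R * √(R * (v * mesh n)) + |c| * (√(mesh n) * M) < ζ * mesh n ^ ϖ)
    (hξ : ξ < √v * (M * |c| / (2 * R) - R ^ 2 - √R - errorConst c R * (l * δ) * M)) :
    detector n horizon ζ ϖ w ξ (fun t => x t + driftBurst c ϑ τ τbar t) s ≤ ((k + v : ℕ) : ℕ∞) := by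
  have hcard : (Finset.Ioc k (k + v)).card = v := by simp
  set y : ℝ≥0 → ℝ := fun t => x t + driftBurst c ϑ τ τbar t with hy
  have hinc : ∀ i, ∃ h : ℝ, i ∈ Finset.Ioc k (k + v) →
      increment n i y = b * mesh n + σ * increment n i W + c * h ∧
        √(mesh n) * M / 2 ≤ h ∧ h ≤ √(mesh n) * M := by
    intro i
    by_cases hi : i ∈ Finset.Ioc k (k + v)
    · obtain ⟨hi1, hi2⟩ := Finset.mem_Ioc.1 hi
      have hi0 : 1 ≤ i := by omega
      have m1 : (obsTime n k : ℝ) ≤ obsTime n (i - 1) := by exact_mod_cast obsTime_mono n (by omega)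
      have m2 : (obsTime n i : ℝ) ≤ obsTime n (k + v) := by exact_mod_cast obsTime_mono n hi2
      obtain ⟨h, h1, h2, h3⟩ := driftBurst_increment (c := c) hϑ0 hϑ1 hu
        (obsTime_mono n (Nat.sub_le i 1)) (hk1.trans m1) (m2.trans hk2) htb
      rw [coe_obsTime_sub hi0, huM] at h2 h3
      refine ⟨h, fun _ => ⟨?_, h2, h3⟩⟩
      have hd := coe_obsTime_sub (n := n) hi0
      simp only [increment, hy, hx i (by omega) hi2, hx (i - 1) (by omega) (by omega)]
      linear_combination h1 + b * hd
    · exact ⟨0, fun h => absurd h hi⟩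
  choose h hh using hinc
  have hlt : ∀ i ∈ Finset.Ioc k (k + v), |increment n i y| < ζ * mesh n ^ ϖ := by
    intro i hi
    obtain ⟨h1, h2, h3⟩ := hh i hi
    have hgi : |increment n i W| ≤ √(R * (v * mesh n)) :=
      Real.abs_le_sqrt ((Finset.single_le_sum (f := fun i => increment n i W ^ 2)
        (fun j _ => sq_nonneg _) hi).trans hg)
    have hh0 : 0 ≤ h i := le_trans (by positivity) h2
    have hσ0 : 0 < σ := lt_of_lt_of_le (by positivity) hσ1
    refine lt_of_le_of_lt ?_ htrunc
    rw [h1]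
    refine (abs_add_three _ _ _).trans ?_
    rw [abs_mul, abs_mul, abs_mul, abs_of_pos hn, abs_of_pos hσ0, abs_of_nonneg hh0]
    gcongr
  have hest : estBM n ζ ϖ y s k (k + v) =
      ∑ i ∈ Finset.Ioc k (k + v), increment n i y / s (obsTime n (i - 1)) :=
    Finset.sum_congr rfl fun i hi => if_pos (hlt i hi)
  have hcore := estimate_lower_bound (Finset.Ioc k (k + v)) (c := c) (l := l) (δ := δ)
    (y := fun i => increment n i y) (g := fun i => increment n i W) (h := h)
    (s := fun i => s (obsTime n (i - 1))) hR hM hn hn1 hl hδ hb hσ1 hσ2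
    (fun i hi => (hh i hi).1) (fun i hi => (hh i hi).2.1) (fun i hi => (hh i hi).2.2)
    (by rwa [hcard])
    (fun i hi => by
      obtain ⟨hi1, hi2⟩ := Finset.mem_Ioc.1 hi
      exact hs (i - 1) (by omega) (by omega))
    (by rwa [hcard])
  rw [hcard, ← hest] at hcore
  unfold detector
  refine iInf₂_le (k + v) ⟨by omega, ?_, k, by omega, by omega, ?_⟩
  · have h1 := (hk2.trans hth)
    rw [coe_obsTime] at h1
    have hnpos : (0 : ℝ) < n := by
      have := hn
      rw [mesh, one_div, inv_pos] at this
      exact this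
    rw [mesh, mul_one_div, div_le_iff₀ hnpos] at h1
    linarith
  · have hv0 : (0 : ℝ) < v := by exact_mod_cast hv1
    have e : (((k + v : ℕ) : ℝ) - (k : ℝ)) * mesh n = v * mesh n := by
      push_cast
      ring
    rw [e, lt_div_iff₀ (Real.sqrt_pos.2 (by positivity)), Real.sqrt_mul hv0.le]
    refine lt_of_lt_of_le ?_ hcore
    have hpos : 0 < √(v : ℝ) * √(mesh n) :=
      mul_pos (Real.sqrt_pos.2 hv0) (Real.sqrt_pos.2 hn)
    refine (mul_lt_mul_of_pos_right hξ hpos).trans_eq ?_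
    linear_combination (√(mesh n) * (M * |c| / (2 * R) - R ^ 2 - √R
      - errorConst c R * (l * δ) * M)) * Real.mul_self_sqrt hv0.le

/-! ### Second moments over a random window -/

section

variable {Ω : Type*} {m mΩ : MeasurableSpace Ω} {P : Measure Ω}

/-- Markov's inequality for the sum of squares over a window whose position `κ` is random but
measurable with respect to `m`, when the conditional second moments given `m` are at most `d`
on an event `G`. -/
lemma measure_window_sum_gt_le [IsProbabilityMeasure P] (hm : m ≤ mΩ) {κ : Ω → ℕ}
    (hκ : Measurable[m] κ) {G : Set Ω} (hG : MeasurableSet[m] G) {g : ℕ → Ω → ℝ}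
    (hg : ∀ i, Measurable (g i)) {d R : ℝ} (hd : 0 < d) (hR : 0 < R) {v : ℕ} (hv : 1 ≤ v)
    (h : ∀ i A, MeasurableSet[m] A → A ⊆ G ∩ {ω | i ∈ Finset.Ioc (κ ω) (κ ω + v)} →
      ∫⁻ ω in A, ENNReal.ofReal (g i ω ^ 2) ∂P ≤ ENNReal.ofReal d * P A) :
    P (G ∩ {ω | R * (v * d) < ∑ i ∈ Finset.Ioc (κ ω) (κ ω + v), g i ω ^ 2}) ≤
      ENNReal.ofReal (1 / R) := by
  have hv0 : (0 : ℝ) < v := by exact_mod_cast hv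
  set S : Ω → ℝ≥0∞ := fun ω =>
    ENNReal.ofReal (∑ i ∈ Finset.Ioc (κ ω) (κ ω + v), g i ω ^ 2) with hS
  have hSm : Measurable S := by
    have : Measurable (fun p : ℕ × Ω => ∑ i ∈ Finset.Ioc p.1 (p.1 + v), g i p.2 ^ 2) :=
      measurable_from_prod_countable_right fun j =>
        Finset.measurable_fun_sum (Finset.Ioc j (j + v)) fun i _ => (hg i).pow_const 2
    exact (this.comp ((hκ.mono hm le_rfl).prodMk measurable_id)).ennreal_ofReal
  have hGj : ∀ j, MeasurableSet[m] (G ∩ κ ⁻¹' {j}) := fun j =>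
    hG.inter (hκ (measurableSet_singleton j))
  have hdisj : Pairwise (Function.onFun Disjoint fun j => G ∩ κ ⁻¹' {j}) := by
    intro i j hij
    refine Set.disjoint_left.2 fun ω h1 h2 => hij ?_
    exact h1.2.symm.trans h2.2
  have hU : ⋃ j, G ∩ κ ⁻¹' {j} = G := by
    rw [← inter_iUnion]
    refine inter_eq_left.2 fun ω _ => mem_iUnion.2 ⟨κ ω, rfl⟩
  have hint : ∫⁻ ω in G, S ω ∂P ≤ ENNReal.ofReal (v * d) := by
    calc ∫⁻ ω in G, S ω ∂P = ∑' j, ∫⁻ ω in G ∩ κ ⁻¹' {j}, S ω ∂P := by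
          rw [← lintegral_iUnion (fun j => hm _ (hGj j)) hdisj, hU]
      _ ≤ ∑' j, ENNReal.ofReal (v * d) * P (G ∩ κ ⁻¹' {j}) := by
          refine ENNReal.tsum_le_tsum fun j => ?_
          have e1 : ∫⁻ ω in G ∩ κ ⁻¹' {j}, S ω ∂P =
              ∫⁻ ω in G ∩ κ ⁻¹' {j}, ∑ i ∈ Finset.Ioc j (j + v),
                ENNReal.ofReal (g i ω ^ 2) ∂P := by
            refine setLIntegral_congr_fun (hm _ (hGj j)) fun ω hω => ?_
            have hωj : κ ω = j := hω.2
            simp only [hS, hωj]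
            exact ENNReal.ofReal_sum_of_nonneg fun i _ => sq_nonneg _
          rw [e1, lintegral_finsetSum _ fun i _ => ((hg i).pow_const 2).ennreal_ofReal]
          refine (Finset.sum_le_sum fun i hi => h i _ (hGj j) ?_).trans_eq ?_
          · rintro ω ⟨h1, h2⟩
            have h2 : κ ω = j := h2
            refine ⟨h1, ?_⟩
            simp only [mem_ofPred_eq, h2]
            exact hi
          · rw [Finset.sum_const, Nat.card_Ioc, Nat.add_sub_cancel_left, nsmul_eq_mul,
              ENNReal.ofReal_mul hv0.le, ENNReal.ofReal_natCast, mul_assoc]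
      _ = ENNReal.ofReal (v * d) * P G := by
          rw [ENNReal.tsum_mul_left, ← measure_iUnion hdisj fun j => hm _ (hGj j), hU]
      _ ≤ ENNReal.ofReal (v * d) := mul_le_of_le_one_right' prob_le_one
  have hpos : 0 < R * (v * d) := by positivity
  have hmk := meas_ge_le_lintegral_div (μ := P.restrict G) (f := S) hSm.aemeasurable
    (ε := ENNReal.ofReal (R * (v * d))) (ENNReal.ofReal_pos.2 hpos).ne' ENNReal.ofReal_ne_top
  rw [Measure.restrict_apply' (hm _ hG)] at hmk
  calc P (G ∩ {ω | R * (v * d) < ∑ i ∈ Finset.Ioc (κ ω) (κ ω + v), g i ω ^ 2})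
      ≤ P ({ω | ENNReal.ofReal (R * (v * d)) ≤ S ω} ∩ G) :=
        measure_mono fun ω hω => ⟨ENNReal.ofReal_le_ofReal (le_of_lt hω.2), hω.1⟩
    _ ≤ ENNReal.ofReal (v * d) / ENNReal.ofReal (R * (v * d)) :=
        hmk.trans (ENNReal.div_le_div_right hint _)
    _ = ENNReal.ofReal (1 / R) := by
        rw [← ENNReal.ofReal_div_of_pos hpos]
        congr 1
        field_simp

/-- Measurable events that almost surely hold eventually have probability tending to one. -/
lemma tendsto_measure_compl_of_ae_eventually [IsProbabilityMeasure P] {D : ℕ → Set Ω}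
    (hD : ∀ n, MeasurableSet (D n)) (h : ∀ᵐ ω ∂P, ∀ᶠ n in atTop, ω ∈ D n) :
    Tendsto (fun n => P (D n)ᶜ) atTop (𝓝 0) := by
  have := tendsto_measure_of_ae_tendsto_indicator_of_isFiniteMeasure (μ := P) (A := ∅)
    (As := fun n => (D n)ᶜ) atTop MeasurableSet.empty (fun n => (hD n).compl) (by
      filter_upwards [h] with ω hω
      filter_upwards [hω] with n hn
      simp [hn])
  simpa using this

end

/-! ### The detection delay -/

section

variable {Ω : Type*} {mΩ : MeasurableSpace Ω} {F : Filtration ℝ≥0 mΩ} {P : Measure Ω}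

lemma IsWienerProcess.setLIntegral_sq_increment {W : ℝ≥0 → Ω → ℝ} (hW : IsWienerProcess F P W)
    {s t : ℝ≥0} (hst : s ≤ t) {A : Set Ω} (hA : MeasurableSet[F s] A) :
    ∫⁻ ω in A, ENNReal.ofReal ((W t ω - W s ω) ^ 2) ∂P =
      ENNReal.ofReal ((t : ℝ) - s) * P A := by
  have hcomap : MeasurableSpace.comap (fun ω => W t ω - W s ω) inferInstance ≤ mΩ :=
    ((hW.measurable t).sub (hW.measurable s)).comap_le
  have h := lintegral_mul_eq_lintegral_mul_lintegral_of_independent_measurableSpace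
    (f := A.indicator 1) (g := fun ω => ENNReal.ofReal ((W t ω - W s ω) ^ 2)) (F.le s) hcomap
    (hW.indep s t hst) (Measurable.indicator (@measurable_const _ _ _ (F s) 1) hA)
    (((comap_measurable (fun ω => W t ω - W s ω)).pow_const 2).ennreal_ofReal)
  rw [hW.lintegral_sq_increment hst, lintegral_indicator_one (F.le s _ hA)] at h
  rw [← lintegral_indicator (F.le s _ hA), mul_comm, ← h]
  refine lintegral_congr fun ω => ?_
  by_cases hω : ω ∈ A <;> simp [hω]

/-- The first observation at least `u` after the start `τ` of the burst. -/
def burstIndex (n : ℕ) (u τ : ℝ) : ℕ := ⌈(τ + u) / mesh n⌉₊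

lemma le_obsTime_burstIndex {n : ℕ} {u τ : ℝ} (hn : 0 < mesh n) :
    τ + u ≤ obsTime n (burstIndex n u τ) := by
  rw [coe_obsTime, ← div_le_iff₀ hn]
  exact Nat.le_ceil _

lemma obsTime_burstIndex_add_le {n v : ℕ} {u τ : ℝ} (hn : 0 < mesh n) (hτ : 0 ≤ τ) (hu : 0 ≤ u)
    (hv : ((v : ℝ) + 1) * mesh n ≤ u) :
    (obsTime n (burstIndex n u τ + v) : ℝ) ≤ τ + 2 * u := by
  have h1 : (burstIndex n u τ : ℝ) < (τ + u) / mesh n + 1 :=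
    Nat.ceil_lt_add_one (div_nonneg (add_nonneg hτ hu) hn.le)
  have h2 : (burstIndex n u τ : ℝ) * mesh n ≤ ((τ + u) / mesh n + 1) * mesh n := by gcongr
  rw [add_mul, div_mul_cancel₀ _ hn.ne'] at h2
  rw [coe_obsTime]
  push_cast
  linarith

/-- The observations up to the time `t` follow a Brownian motion with drift `b 0` and volatility
`σ 0`. -/
def FollowsBrownianUpTo (W b σ X : ℝ≥0 → Ω → ℝ) (n : ℕ) (t : ℝ) (ω : Ω) : Prop :=
  ∀ i : ℕ, (obsTime n i : ℝ) ≤ t → σ (obsTime n i) ω = σ 0 ω ∧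
    X (obsTime n i) ω = X 0 ω + b 0 ω * obsTime n i + σ 0 ω * W (obsTime n i) ω

lemma measurableSet_followsBrownianUpTo {W b σ X : ℝ≥0 → Ω → ℝ} (hW : ∀ t, Measurable (W t))
    (hb : Measurable (b 0)) (hσ : ∀ t, Measurable (σ t)) (hX : ∀ t, Measurable (X t)) (n : ℕ)
    {t : Ω → ℝ} (ht : Measurable t) :
    MeasurableSet {ω | FollowsBrownianUpTo W b σ X n (t ω) ω} := by
  have : {ω | FollowsBrownianUpTo W b σ X n (t ω) ω} = ⋂ i : ℕ,
      ({ω | (obsTime n i : ℝ) ≤ t ω}ᶜ ∪ ({ω | σ (obsTime n i) ω = σ 0 ω} ∩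
        {ω | X (obsTime n i) ω = X 0 ω + b 0 ω * obsTime n i + σ 0 ω * W (obsTime n i) ω})) := by
    ext ω
    simp only [FollowsBrownianUpTo, mem_ofPred_eq, mem_iInter, mem_union, mem_compl_iff,
      mem_inter_iff, imp_iff_not_or]
  rw [this]
  refine MeasurableSet.iInter fun i => ?_
  exact (measurableSet_le measurable_const ht).compl.union
    ((measurableSet_eq_fun (hσ _) (hσ 0)).inter (measurableSet_eq_fun (hX _)
      (((hX 0).add (hb.mul_const _)).add ((hσ 0).mul (hW _)))))

/-- The probability of a late detection tends to zero: every path on which the price follows a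
Brownian motion with drift near time zero, the noise and estimation errors are moderate and the
initial values are bounded is detected in the window of length `window w ξ n` that starts
`burstLag ϑ β n` after the burst. -/
theorem tendsto_measure_detector_gt [IsProbabilityMeasure P]
    {W : ℝ≥0 → Ω → ℝ} {ν : Measure ℝ} {N : Ω → Measure (ℝ≥0 × ℝ)}
    {b σ : ℝ≥0 → Ω → ℝ} {jumpSize : Ω → ℝ≥0 → ℝ → ℝ} {X : ℝ≥0 → Ω → ℝ}
    (hX : IsItoSemimartingale F P W ν N b σ jumpSize X)
    (hconst : ∀ᵐ ω ∂P, ∀ᶠ s in 𝓝 (0 : ℝ≥0),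
      b s ω = b 0 ω ∧ σ s ω = σ 0 ω ∧ jump (fun u => X u ω) s = 0)
    {σhat : ℕ → ℝ≥0 → Ω → ℝ} (hσhat_meas : ∀ n t, Measurable (σhat n t))
    {δ : ℕ → ℝ} (hσhat : SpotVolAccuracy F P σ σhat δ)
    {c ϑ : ℝ} (hc : c ≠ 0) (hϑ : ϑ ∈ Set.Ioo (1 / 2 : ℝ) 1)
    {τ : ℕ → Ω → ℝ} (hτ_meas : ∀ n, Measurable[F 0] (τ n))
    (hτ : ∀ᵐ ω ∂P, (∀ n, 0 ≤ τ n ω) ∧ Tendsto (fun n => τ n ω) atTop (𝓝 0))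
    {τbar : Ω → ℝ} (hτbar_meas : Measurable τbar) (hτbar : ∀ᵐ ω ∂P, 0 < τbar ω)
    {horizon : ℝ} (hhorizon : 0 < horizon)
    {ζ ϖ : ℝ} (hζ : 0 < ζ) (hϖ : ϖ < 1 / 2)
    {ξ : ℕ → ℝ} (hξ_pos : ∀ n, 0 < ξ n)
    (hξ : ∀ ι : ℝ, 0 < ι → Tendsto (fun n => ξ n * mesh n ^ ι) atTop (𝓝 0))
    {w : ℕ → ℕ} {a : ℕ → ℝ} {aLim : EReal}
    (ha : Tendsto (fun n => (a n : EReal)) atTop (𝓝 aLim))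
    (haLim : ((2 / c ^ 2 : ℝ) : EReal) < aLim)
    (hw : Tendsto (fun n => (w n : ℝ) / (a n * ξ n ^ 2)) atTop (𝓝 1))
    {T : ℕ → ℝ}
    (hT_rate : Tendsto (fun n => T n / mesh n ^ ((1 / 2 - ϑ) / ϑ)) atTop atTop) :
    Tendsto (fun n => P {ω | ((τ n ω / mesh n + T n : ℝ) : EReal) <
        ((detector n horizon ζ ϖ (w n) (ξ n)
          (fun t => X t ω + driftBurst c ϑ (τ n ω) (τbar ω) t)
          (fun t => σhat n t ω) : ℝ≥0∞) : EReal)}) atTop (𝓝 0) := by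
  obtain ⟨hδ, hδ0, t₀, ht₀, hσlow, ⟨C, hCm, -, hC⟩, ⟨C', hC'm, hC'pos, hC'⟩⟩ := hσhat
  obtain ⟨β, hβ⟩ := exists_isBurstExponent hϑ.1 hϖ
  have hWm := hX.wiener.measurable
  have hσm : ∀ t, Measurable (σ t) := fun t => (hX.vol_prog.adapted t).mono (F.le t) le_rfl
  have hXm : ∀ t, Measurable (X t) := fun t => (hX.adapted t).mono (F.le t) le_rfl
  have hσ0 : Measurable[F 0] (σ 0) := hX.vol_prog.adapted 0
  have hb0 : Measurable[F 0] (b 0) := hX.drift_prog.adapted 0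
  have hτm : ∀ n, Measurable (τ n) := fun n => (hτ_meas n).mono (F.le 0) le_rfl
  set u := burstLag ϑ β with hu
  set v := window w ξ with hv
  -- the paths on which the burst lies in the neighbourhood of zero
  set D : ℕ → Set Ω := fun n => {ω | 0 ≤ τ n ω} ∩ {ω | τ n ω + 2 * u n ≤ τbar ω} ∩
    {ω | τ n ω + 2 * u n ≤ min horizon t₀} ∩
    {ω | FollowsBrownianUpTo W b σ X n (τ n ω + 2 * u n) ω} with hD
  have hDm : ∀ n, MeasurableSet (D n) := fun n => by
    have hm : Measurable fun ω => τ n ω + 2 * u n := (hτm n).add_const _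
    exact (((measurableSet_le measurable_const (hτm n)).inter
      (measurableSet_le hm hτbar_meas)).inter (measurableSet_le hm measurable_const)).inter
      (measurableSet_followsBrownianUpTo hWm (hb0.mono (F.le 0) le_rfl) hσm hXm n hm)
  have hDlim : Tendsto (fun n => P (D n)ᶜ) atTop (𝓝 0) := by
    refine tendsto_measure_compl_of_ae_eventually hDm ?_
    filter_upwards [hX.eq_near_zero hconst, hτ, hτbar] with ω ⟨r, hr, hω⟩ hτω hτb
    have hlim : Tendsto (fun n => τ n ω + 2 * u n) atTop (𝓝 0) := by
      simpa using hτω.2.add (hβ.tendsto_burstLag.const_mul 2)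
    filter_upwards [hlim.eventually_lt_const hr, hlim.eventually_le_const hτb,
      hlim.eventually_le_const (lt_min hhorizon (NNReal.coe_pos.2 ht₀))] with n h1 h2 h3
    exact ⟨⟨⟨hτω.1 n, h2⟩, h3⟩, fun i hi => hω n i (hi.trans_lt h1)⟩
  -- the paths with bounded initial values
  set G : ℝ → Set Ω := fun R => {ω | 1 / R ≤ σ 0 ω} ∩ {ω | σ 0 ω ≤ R} ∩ {ω | |b 0 ω| ≤ R} ∩
    {ω | C ω ≤ R} ∩ {ω | 1 / R ≤ C' ω} with hG
  have hGm : ∀ R, MeasurableSet[F 0] (G R) := fun R =>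
    ((((measurableSet_le measurable_const hσ0).inter (measurableSet_le hσ0 measurable_const)).inter
      (measurableSet_le (continuous_abs.measurable.comp hb0) measurable_const)).inter
      (measurableSet_le hCm measurable_const)).inter (measurableSet_le measurable_const hC'm)
  have hGlim : Tendsto (fun j : ℕ => P (G j)ᶜ) atTop (𝓝 0) := by
    refine tendsto_measure_compl_of_ae_eventually (fun j => F.le 0 _ (hGm j)) ?_
    filter_upwards [hσlow] with ω ⟨r, hr, hω⟩
    have hσpos : 0 < σ 0 ω := hr.trans_le (hω 0 zero_le)
    have hcast := tendsto_natCast_atTop_atTop (R := ℝ)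
    have hinv : Tendsto (fun j : ℕ => 1 / (j : ℝ)) atTop (𝓝 0) :=
      tendsto_one_div_atTop_nhds_zero_nat
    filter_upwards [hinv.eventually_le_const hσpos, hcast.eventually_ge_atTop (σ 0 ω),
      hcast.eventually_ge_atTop |b 0 ω|, hcast.eventually_ge_atTop (C ω),
      hinv.eventually_le_const (hC'pos ω)] with j h1 h2 h3 h4 h5
    exact ⟨⟨⟨⟨h1, h2⟩, h3⟩, h4⟩, h5⟩
  have key : ∀ R : ℝ, 1 ≤ R → ∀ᶠ n in atTop,
      P {ω | ((τ n ω / mesh n + T n : ℝ) : EReal) <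
        ((detector n horizon ζ ϖ (w n) (ξ n)
          (fun t => X t ω + driftBurst c ϑ (τ n ω) (τbar ω) t)
          (fun t => σhat n t ω) : ℝ≥0∞) : EReal)} ≤
      P (D n)ᶜ + P (G R)ᶜ + ENNReal.ofReal (1 / R) + ENNReal.ofReal (1 / R) := by
    intro R hR
    have hR0 : 0 < R := by linarith
    filter_upwards [eventually_mesh_pos, hC, hC', hδ0.eventually_lt_const zero_lt_one,
      (tendsto_mesh.mono_right nhdsWithin_le_nhds).eventually_le_const zero_lt_one,
      hβ.window_le (w := w) hξ, hβ.two_mul_burstLag_le hT_rate,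
      hβ.tendsto_burstRatio.eventually_ge_atTop 1,
      hβ.increment_lt_truncation hϖ hζ (w := w) hξ c R,
      hβ.threshold_lt hc hξ_pos ha haLim hw hδ hδ0 hR0,
      window_lower_bound hc hξ_pos ha haLim hw]
      with n hn hCn hC'n hδn hn1 hwin hlag hM htrunc hthr hv1
    have hl : 0 < logRate δ n := Real.log_pos ((one_lt_div (hδ n)).2 hδn)
    have hupos : 0 < u n := Real.rpow_pos_of_pos hn _
    set κ : Ω → ℕ := fun ω => burstIndex n (u n) (τ n ω) with hκ
    have hκm : Measurable[F 0] κ :=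
      Nat.measurable_ceil.comp (((hτ_meas n).add_const _).div_const _)
    set B₁ : Set Ω := univ ∩ {ω | R * (v n * mesh n) <
      ∑ i ∈ Finset.Ioc (κ ω) (κ ω + v n), increment n i (fun t => W t ω) ^ 2} with hB₁
    have hPB₁ : P B₁ ≤ ENNReal.ofReal (1 / R) := by
      refine measure_window_sum_gt_le (F.le 0) hκm MeasurableSet.univ
        (g := fun i ω => increment n i (fun t => W t ω)) (fun i => (hWm _).sub (hWm _))
        hn hR0 hv1.1 fun i A hA _ => ?_
      have hle : obsTime n (i - 1) ≤ obsTime n i := obsTime_mono n (Nat.sub_le i 1)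
      simp only [increment]
      rw [hX.wiener.setLIntegral_sq_increment hle (F.mono zero_le A hA), coe_obsTime, coe_obsTime]
      gcongr
      have : (i : ℝ) ≤ ((i - 1 : ℕ) : ℝ) + 1 := by exact_mod_cast (by omega : i ≤ i - 1 + 1)
      nlinarith
    set G' : Set Ω := G R ∩ ({ω | 0 ≤ τ n ω} ∩ {ω | τ n ω + 2 * u n ≤ t₀}) with hG'
    have hG'm : MeasurableSet[F 0] G' := (hGm R).inter
      ((measurableSet_le measurable_const (hτ_meas n)).inter
        (measurableSet_le ((hτ_meas n).add_const _) measurable_const))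
    set B₂ : Set Ω := G' ∩ {ω | R * (v n * (R * δ n ^ 2)) < ∑ i ∈ Finset.Ioc (κ ω) (κ ω + v n),
      (σhat n (obsTime n (i - 1)) ω - σ (obsTime n (i - 1)) ω) ^ 2} with hB₂
    have hPB₂ : P B₂ ≤ ENNReal.ofReal (1 / R) := by
      refine measure_window_sum_gt_le (F.le 0) hκm hG'm
        (g := fun i ω => σhat n (obsTime n (i - 1)) ω - σ (obsTime n (i - 1)) ω)
        (fun i => (hσhat_meas n _).sub (hσm _)) (by have := hδ n; positivity) hR0 hv1.1
        fun i A hA hAG => ?_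
      rcases A.eq_empty_or_nonempty with rfl | ⟨ω₀, hω₀⟩
      · simp
      obtain ⟨⟨-, h1, h2⟩, h3⟩ := hAG hω₀
      have hit : obsTime n (i - 1) ≤ t₀ := by
        have h4 := (obsTime_burstIndex_add_le hn h1 hupos.le hwin).trans h2
        have h5 : obsTime n (burstIndex n (u n) (τ n ω₀) + v n) ≤ t₀ := by exact_mod_cast h4
        exact (obsTime_mono n ((Nat.sub_le i 1).trans (Finset.mem_Ioc.1 h3).2)).trans h5
      simp only [← sq_abs (σhat n (obsTime n (i - 1)) _ - _)]
      rw [← setLIntegral_condLExp (F.le 0) P _ hA]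
      calc _ ≤ ∫⁻ ω in A, ENNReal.ofReal (C ω * δ n ^ 2) ∂P :=
            lintegral_mono_ae (ae_restrict_of_ae (hCn _ hit))
        _ ≤ ∫⁻ _ in A, ENNReal.ofReal (R * δ n ^ 2) ∂P := by
            refine setLIntegral_mono' (F.le 0 _ hA) fun ω hω => ENNReal.ofReal_le_ofReal ?_
            have : C ω ≤ R := (hAG hω).1.1.1.2
            gcongr
        _ = _ := setLIntegral_const _ _
    have hbelow : ∀ᵐ ω ∂P, ∀ i : ℕ, obsTime n i ≤ t₀ →
        C' ω / logRate δ n < σhat n (obsTime n i) ω := by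
      refine ae_all_iff.2 fun i => ?_
      by_cases hi : obsTime n i ≤ t₀
      · filter_upwards [hC'n _ hi] with ω hω _
        exact hω
      · exact ae_of_all _ fun ω h => absurd h hi
    refine (measure_mono_ae (t := (D n)ᶜ ∪ (G R)ᶜ ∪ B₁ ∪ B₂) ?_).trans ?_
    · filter_upwards [hbelow] with ω hωbelow hfail
      by_contra hgood
      have hgood : ω ∉ (D n)ᶜ ∪ (G R)ᶜ ∪ B₁ ∪ B₂ := hgood
      simp only [mem_union, not_or, mem_compl_iff, not_not] at hgood
      obtain ⟨⟨⟨hωD, hωG⟩, hωB₁⟩, hωB₂⟩ := hgood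
      obtain ⟨⟨⟨hτ0, htb⟩, hth⟩, hfol⟩ := hωD
      have hτ0 : 0 ≤ τ n ω := hτ0
      have hth : τ n ω + 2 * u n ≤ min horizon t₀ := hth
      have hωB₁' : ∑ i ∈ Finset.Ioc (κ ω) (κ ω + v n), increment n i (fun t => W t ω) ^ 2 ≤
          R * (v n * mesh n) := not_lt.1 fun h => hωB₁ ⟨trivial, h⟩
      have hωB₂' : ∑ i ∈ Finset.Ioc (κ ω) (κ ω + v n),
          (σhat n (obsTime n (i - 1)) ω - σ (obsTime n (i - 1)) ω) ^ 2 ≤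
          R * (v n * (R * δ n ^ 2)) :=
        not_lt.1 fun h => hωB₂ ⟨⟨hωG, hτ0, hth.trans (min_le_right _ _)⟩, h⟩
      obtain ⟨⟨⟨⟨hσ1, hσ2⟩, hbR⟩, -⟩, hC'R⟩ := hωG
      have hk2 := obsTime_burstIndex_add_le hn hτ0 hupos.le hwin
      have hle : ∀ i, i ≤ κ ω + v n → (obsTime n i : ℝ) ≤ τ n ω + 2 * u n := fun i hi =>
        le_trans (by exact_mod_cast obsTime_mono n hi) hk2
      have hdet := detector_le_of_window (n := n) (w := w n) (k := κ ω) (v := v n)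
        (x := fun t => X t ω) (W := fun t => W t ω) (s := fun t => σhat n t ω)
        (horizon := horizon) (ζ := ζ) (ϖ := ϖ) (ξ := ξ n) (c := c) (ϑ := ϑ) (τ := τ n ω)
        (τbar := τbar ω) (u := u n) (R := R) (M := burstRatio β n) (b := b 0 ω) (σ := σ 0 ω)
        (x0 := X 0 ω) (l := logRate δ n) (δ := δ n)
        hn hn1 hv1.1 (min_le_left _ _) (by linarith [hϑ.1]) hϑ.2 hupos
        (hβ.mesh_mul_burstLag hn) hR hM hl (hδ n) (le_obsTime_burstIndex hn) hk2 htb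
        (hth.trans (min_le_left _ _)) (fun i _ hi => (hfol i (hle i hi)).2) hbR hσ1 hσ2 hωB₁'
        (fun i _ hi => ?_) ?_ htrunc hthr
      · have hnum : (κ ω + v n : ℕ) ≤ τ n ω / mesh n + T n := by
          have h1 := hk2
          rw [coe_obsTime] at h1
          have h2 : ((κ ω + v n : ℕ) : ℝ) * mesh n ≤ (τ n ω / mesh n + T n) * mesh n := by
            rw [add_mul, div_mul_cancel₀ _ hn.ne']
            exact h1.trans (by linarith)
          exact le_of_mul_le_mul_right h2 hn
        have hfail : ((τ n ω / mesh n + T n : ℝ) : EReal) <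
          ((detector n horizon ζ ϖ (w n) (ξ n)
            (fun t => X t ω + driftBurst c ϑ (τ n ω) (τbar ω) t)
            (fun t => σhat n t ω) : ℝ≥0∞) : EReal) := hfail
        refine absurd hfail (not_lt.2 ?_)
        calc ((detector n horizon ζ ϖ (w n) (ξ n)
              (fun t => X t ω + driftBurst c ϑ (τ n ω) (τbar ω) t)
              (fun t => σhat n t ω) : ℝ≥0∞) : EReal)
            ≤ ((((κ ω + v n : ℕ) : ℕ∞) : ℝ≥0∞) : EReal) := by exact_mod_cast hdet
          _ = (((κ ω + v n : ℕ) : ℝ) : EReal) := by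
              rw [ENat.toENNReal_coe, ← ENNReal.ofReal_natCast, EReal.coe_ennreal_ofReal,
                max_eq_left (Nat.cast_nonneg _)]
          _ ≤ _ := EReal.coe_le_coe_iff.2 hnum
      · have hi' : obsTime n i ≤ t₀ := by
          exact_mod_cast (hle i hi.le).trans (hth.trans (min_le_right _ _))
        refine le_trans ?_ (hωbelow i hi').le
        have hC'R : 1 / R ≤ C' ω := hC'R
        gcongr
      · have h1 : ∀ i ∈ Finset.Ioc (κ ω) (κ ω + v n),
            (σhat n (obsTime n (i - 1)) ω - σ 0 ω) ^ 2 =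
            (σhat n (obsTime n (i - 1)) ω - σ (obsTime n (i - 1)) ω) ^ 2 := fun i hi => by
          rw [(hfol (i - 1) (hle _ ((Nat.sub_le i 1).trans (Finset.mem_Ioc.1 hi).2))).1]
        rw [Finset.sum_congr rfl h1]
        refine hωB₂'.trans_eq ?_
        ring
    · refine (measure_union_le _ _).trans (add_le_add ?_ hPB₂)
      exact (measure_union_le _ _).trans (add_le_add (measure_union_le _ _) hPB₁)
  -- let first `n`, then `R` tend to infinity
  refine ENNReal.tendsto_nhds_zero.2 fun ε hε => ?_
  have hε4 : 0 < ε / 4 := ENNReal.div_pos hε.ne' (by norm_num)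
  have hinv : Tendsto (fun j : ℕ => ENNReal.ofReal (1 / (j : ℝ))) atTop (𝓝 0) := by
    have := ENNReal.tendsto_ofReal (tendsto_one_div_atTop_nhds_zero_nat (𝕜 := ℝ))
    rwa [ENNReal.ofReal_zero] at this
  obtain ⟨j, h1, h2, h3⟩ := ((ENNReal.tendsto_nhds_zero.1 hGlim _ hε4).and
    ((ENNReal.tendsto_nhds_zero.1 hinv _ hε4).and (eventually_ge_atTop 1))).exists
  filter_upwards [key j (by exact_mod_cast h3), ENNReal.tendsto_nhds_zero.1 hDlim _ hε4]
    with n h4 h5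
  calc _ ≤ ε / 4 + ε / 4 + ε / 4 + ε / 4 :=
        h4.trans (add_le_add (add_le_add (add_le_add h5 h1) h2) h2)
    _ = ε := by
      have h6 : ε / 4 + ε / 4 + ε / 4 + ε / 4 = 4 * (ε / 4) := by ring
      rw [h6]
      exact ENNReal.mul_div_cancel (by norm_num) (by norm_num)

end

end

end RealTimeDetection

theorem theorem2 {Ω : Type*} {mΩ : MeasurableSpace Ω} (F : Filtration ℝ≥0 mΩ)
    (P : Measure Ω) [IsProbabilityMeasure P]
    -- the efficient price
    (W : ℝ≥0 → Ω → ℝ) (ν : Measure ℝ) [SigmaFinite ν] (N : Ω → Measure (ℝ≥0 × ℝ))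
    (b σ : ℝ≥0 → Ω → ℝ) (jumpSize : Ω → ℝ≥0 → ℝ → ℝ) (X : ℝ≥0 → Ω → ℝ)
    (hX : RealTimeDetection.IsItoSemimartingale F P W ν N b σ jumpSize X)
    -- constant drift and volatility, and no jumps, in a neighbourhood of zero
    (hconst : ∀ᵐ ω ∂P, ∀ᶠ s in 𝓝 (0 : ℝ≥0),
      b s ω = b 0 ω ∧ σ s ω = σ 0 ω ∧ RealTimeDetection.jump (fun u => X u ω) s = 0)
    -- the spot volatility estimator
    (σhat : ℕ → ℝ≥0 → Ω → ℝ) (hσhat_meas : ∀ n t, Measurable (σhat n t))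
    (δ : ℕ → ℝ) (hσhat : RealTimeDetection.SpotVolAccuracy F P σ σhat δ)
    -- the drift burst
    (c ϑ : ℝ) (hc : c ≠ 0) (hϑ : ϑ ∈ Set.Ioo (1 / 2 : ℝ) 1)
    (τ : ℕ → Ω → ℝ) (hτ_meas : ∀ n, Measurable[F 0] (τ n))
    (hτ : ∀ᵐ ω ∂P, (∀ n, 0 ≤ τ n ω) ∧ Tendsto (fun n => τ n ω) atTop (𝓝 0))
    (τbar : Ω → ℝ) (hτbar_meas : Measurable τbar)
    (hτbar : ∀ᵐ ω ∂P, 0 < τbar ω ∧ ∀ n, τ n ω ≤ τbar ω)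
    -- horizon, truncation, threshold and window
    (horizon : ℝ) (hhorizon : 0 < horizon)
    (ζ ϖ : ℝ) (hζ : 0 < ζ) (hϖ : ϖ ∈ Set.Ioo (0 : ℝ) (1 / 2))
    (ξ : ℕ → ℝ) (hξ_pos : ∀ n, 0 < ξ n)
    (hξ : ∀ ι : ℝ, 0 < ι →
      Tendsto (fun n => ξ n * RealTimeDetection.mesh n ^ ι) atTop (𝓝 0))
    (w : ℕ → ℕ) (a : ℕ → ℝ) (aLim : EReal)
    (ha : Tendsto (fun n => (a n : EReal)) atTop (𝓝 aLim))
    (haLim : ((2 / c ^ 2 : ℝ) : EReal) < aLim)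
    (hw : Tendsto (fun n => (w n : ℝ) / (a n * ξ n ^ 2)) atTop (𝓝 1))
    -- the bound on the detection delay
    (T : ℕ → ℝ) (hT : Tendsto T atTop atTop)
    (hT_mesh : Tendsto (fun n => T n * RealTimeDetection.mesh n) atTop (𝓝 0))
    (hT_window : Tendsto (fun n => (w n : ℝ) / T n) atTop (𝓝 0))
    (hT_rate : Tendsto
      (fun n => T n / RealTimeDetection.mesh n ^ ((1 / 2 - ϑ) / ϑ)) atTop atTop)
    (hT_vol : Tendsto
      (fun n => √(w n : ℝ) * RealTimeDetection.logRate δ n * δ n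
        * RealTimeDetection.mesh n ^ (ϖ - 1 / 2) / (ξ n * T n)) atTop (𝓝 0)) :
    Tendsto (fun n => P {ω |
      ((τ n ω / RealTimeDetection.mesh n + T n : ℝ) : EReal) <
        ((RealTimeDetection.detector n horizon ζ ϖ (w n) (ξ n)
          (fun t => X t ω + RealTimeDetection.driftBurst c ϑ (τ n ω) (τbar ω) t)
          (fun t => σhat n t ω) : ℝ≥0∞) : EReal)}) atTop (𝓝 0) := by
  exact RealTimeDetection.tendsto_measure_detector_gt hX hconst hσhat_meas hσhat hc hϑ hτ_meas hτ
    hτbar_meas (hτbar.mono fun _ h => h.1) hhorizon hζ hϖ.2 hξ_pos hξ ha haLim hw hT_rate
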